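/- Strings are finite binary strings, $|x|$ is the length of $x$, $S\upharpoonright m$ is the prefix of length $m$ of an infinite sequence $S$, and $\mathrm{occ}(w,x)$ is the number of strings $u$ such that $uw$ is a prefix of $x$. **The sequence $S$.** A de Bruijn string of order $n$ is a string $x$ of length $2^n$ such that every string of length $n$ occurs exactly once in $x$ viewed cyclically. Let $db(n)$ be the lexicographically least one, let $db_i(n)$ be its cyclic left shift by $i$ bits, and let $db_i^t(n)$ be $db_i(n)$ repeated $t$ times. For $n=2^s t$ with $n\ge 1$ and $t$ odd put $S_n=db_0^t(n)\,db_1^t(n)\cdots db_{2^s-1}^t(n)$, and let $S=S_1S_2S_3\cdots\in\{0,1\}^\omega$. **The compressor $\mathrm{PPM}^*$** (Method C escapes, no exclusion, exact arithmetic coding). Suppose that $x$ has been read. In a context $w$ each bit $b$ has frequency $\mathrm{occ}(wb,x)$, and the escape symbol has as frequency the number of distinct bits $b$ with $\mathrm{occ}(wb,x)>0$; the probability of a symbol in the context is its frequency divided by the sum of these three frequencies. The context $w$ is in the model if its escape frequency is positive and either $w$ is empty or $w=vb$ with a bit $b$ and $\mathrm{occ}(v,x)\ge 2$. The relevant contexts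 are the suffixes of $x$ that are in the model. The next bit is encoded starting from the shortest relevant context with escape frequency $1$, or from the longest relevant context if there is none. As long as the current context has frequency $0$ for the bit, an escape is transmitted and the next shorter relevant context becomes current; otherwise the bit is transmitted with its probability in the current context. If no relevant context is left, the bit is transmitted with probability $1/2$. Starting from $[0,1)$, each transmitted symbol replaces the current interval by its subinterval, the interval being divided in the order $0$, $1$, escape in proportion to the probabilities. If $[a,b)$ is the final interval for the input $x$ and $k=\lceil-\log_2(b-a)\rceil$, then the output $\mathrm{PPM}^*(x)$ consists of the $k$ bits after the binary point of the least multiple of $2^{-k}$ that is at least $a$ (it lies in $[a,b)$). **Theorem.** The worst-case compression ratio of $\mathrm{PPM}^*$ on $S$ is $0$: $$R_{\mathrm{PPM}^*}(S)=\limsup_{m\to\infty}\frac{|\mathrm{PPM}^*(S\upharpoonright m)|}{m}=0 .$$ -/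

import Mathlib

namespace PPMStar

/-! ### Strings, occurrences and compression ratios

Finite binary strings are `List Bool` (`false` is the bit 0, `true` is the bit 1), infinite binary
sequences are functions `ℕ → Bool`. -/

/-- The number of occurrences of `w` as a substring of `x`, i.e. the number of strings `u` such
that `u ++ w` is a prefix of `x`: the number of positions of `x` (the end included) at which `w`
can be read. -/
def occ (w x : List Bool) : ℕ :=
  x.tails.countP fun y => w.isPrefixOf y

/-- The prefix of length `n` of the infinite sequence `S`. -/
def initial (S : ℕ → Bool) (n : ℕ) : List Bool :=
  (List.range n).map S

/-- The worst-case compression ratio of `T` on `S`: the limit superior of `|T(S↾n)| / n`. It is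
taken in `[0, ∞]`, so that it always is a genuine limit superior. -/
noncomputable def worstCaseRatio (T : List Bool → List Bool) (S : ℕ → Bool) : ENNReal :=
  Filter.limsup (fun n : ℕ => ((T (initial S n)).length : ENNReal) / (n : ENNReal)) Filter.atTop

/-! ### The sequence -/

/-- `x` is a de Bruijn string of order `n`: it has length `2 ^ n` and, viewed cyclically, it
contains every binary string of length `n` exactly once. -/
def IsDeBruijn (n : ℕ) (x : List Bool) : Prop :=
  x.length = 2 ^ n ∧ ∀ w : List Bool, w.length = n → occ w (x ++ x.take (n - 1)) = 1

open Classical in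
/-- The least de Bruijn string of order `n`, strings being ordered by length first and
lexicographically (with 0 before 1) within one length. De Bruijn strings of every order
`n ≥ 1` exist, so the second alternative is never used for such `n`. -/
noncomputable def db (n : ℕ) : List Bool :=
  if h : {x : List Bool | IsDeBruijn n x}.Nonempty then
    (List.Shortlex.wf (r := fun a b : Bool => a < b) wellFounded_lt).min
      {x : List Bool | IsDeBruijn n x} h
  else []

/-- The exponent `s` in `n = 2 ^ s * t` with `t` odd (for `n ≥ 1`). -/
def twoExp (n : ℕ) : ℕ := padicValNat 2 n

/-- The odd factor `t` in `n = 2 ^ s * t` (for `n ≥ 1`). -/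
def oddFactor (n : ℕ) : ℕ := n / 2 ^ twoExp n

/-- The `i`-th block of the `n`-th section: the cyclic left shift by `i` bits of `db n`, repeated
`t` times, where `n = 2 ^ s * t` with `t` odd. -/
noncomputable def block (n i : ℕ) : List Bool :=
  (List.replicate (oddFactor n) ((db n).rotate i)).flatten

/-- The `n`-th section `S_n` of the sequence: its blocks `0, …, 2 ^ s - 1` in this order. -/
noncomputable def sec (n : ℕ) : List Bool :=
  (List.range (2 ^ twoExp n)).flatMap fun i => block n i

/-- The concatenation `S_1 S_2 ⋯ S_n` of the first `n` sections. -/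
noncomputable def firstSecs (n : ℕ) : List Bool :=
  (List.range n).flatMap fun j => sec (j + 1)

/-- The infinite sequence `S = S_1 S_2 S_3 ⋯`. Each section is non-empty, so bit `k` (counted
from 0) is found in `S_1 ⋯ S_{k+1}`. -/
noncomputable def seqS (k : ℕ) : Bool :=
  (firstSecs (k + 1)).getD k false

/-! ### The model of PPM*

In what follows `x` is the part of the input that has been read so far. -/

/-- The frequency count of the bit `b` in the context `w`: how often `w` was followed by `b`. -/
def cnt (x w : List Bool) (b : Bool) : ℕ :=
  occ (w ++ [b]) x

/-- The frequency count of the escape symbol in the context `w` (Method C): the number of distinct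
bits that have been seen after `w`. -/
def escCnt (x w : List Bool) : ℕ :=
  (if 0 < cnt x w false then 1 else 0) + (if 0 < cnt x w true then 1 else 0)

/-- The sum of all frequency counts in the context `w`, the escape symbol included. -/
def total (x w : List Bool) : ℕ :=
  cnt x w false + cnt x w true + escCnt x w

/-- The context `w` is in the model: it predicts something, and it is the empty context or extends
by one bit a string that is not unique in `x`. -/
def InModel (x w : List Bool) : Prop :=
  0 < escCnt x w ∧ (w = [] ∨ 2 ≤ occ w.dropLast x)

instance (x w : List Bool) : Decidable (InModel x w) :=
  inferInstanceAs (Decidable (_ ∧ _))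

/-- The relevant contexts: the suffixes of `x` that are in the model, from long to short. -/
def relevant (x : List Bool) : List (List Bool) :=
  x.tails.filter fun w => InModel x w

/-- The first current context: the shortest deterministic relevant context (escape count 1), or
the longest relevant context if none is deterministic; `none` if nothing is relevant, which
happens only before the first bit is read. -/
def startContext (x : List Bool) : Option (List Bool) :=
  match (relevant x).reverse.find? fun w => escCnt x w = 1 with
  | some w => some w
  | none => (relevant x).head?

/-- The contexts that are tried one after the other to encode the next bit: the relevant contexts
from the first current context downwards. -/
def contextChain (x : List Bool) : List (List Bool) :=
  match startContext x with
  | some w => (relevant x).filter fun v => v.length ≤ w.length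
  | none => []

/-! ### Arithmetic coding with exact arithmetic

A half-open interval `[lo, lo + width)` is stored as the pair `(lo, width)`. -/

/-- The part of the interval `I` that belongs to a symbol with frequency `c` out of `T`, if the
symbols before it have total frequency `below`. -/
def narrow (I : ℚ × ℚ) (below c T : ℕ) : ℚ × ℚ :=
  (I.1 + I.2 * (below / T), I.2 * (c / T))

/-- Encode the bit `b` after `x`, trying the listed contexts in turn. An interval is divided in the
order 0, 1, escape. A context that does not predict `b` transmits an escape. When no context is
left, both bits have probability 1/2. -/
def encodeBit (x : List Bool) (b : Bool) : List (List Bool) → ℚ × ℚ → ℚ × ℚ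
  | [], I => narrow I (if b then 1 else 0) 1 2
  | w :: ws, I =>
    if 0 < cnt x w b then
      narrow I (if b then cnt x w false else 0) (cnt x w b) (total x w)
    else
      encodeBit x b ws (narrow I (cnt x w false + cnt x w true) (escCnt x w) (total x w))

/-- Process the remaining input when `x` has been read and `I` is the current interval. -/
def encodeFrom (x : List Bool) (I : ℚ × ℚ) : List Bool → ℚ × ℚ
  | [] => I
  | b :: y => encodeFrom (x ++ [b]) (encodeBit x b (contextChain x) I) y

/-- The final interval for the input `x`; the initial interval is `[0, 1)`. -/
def finalInterval (x : List Bool) : ℚ × ℚ :=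
  encodeFrom [] (0, 1) x

/-- The number of bits that are sent for an interval: `⌈-log₂ width⌉`. -/
noncomputable def codeLength (I : ℚ × ℚ) : ℕ :=
  ⌈-Real.logb 2 (I.2 : ℝ)⌉₊

/-- The code of an interval: with `k = codeLength I`, the `k` bits after the binary point of the
least multiple of `2 ^ (-k)` that is at least the left endpoint (it lies in the interval, because
`2 ^ (-k) ≤ width`). -/
noncomputable def arithCode (I : ℚ × ℚ) : List Bool :=
  List.ofFn fun i : Fin (codeLength I) =>
    (⌈I.1 * 2 ^ codeLength I⌉₊).testBit (codeLength I - 1 - i)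

/-- The output of the compressor PPM* on the input `x`. -/
noncomputable def ppmStar (x : List Bool) : List Bool :=
  arithCode (finalInterval x)

end PPMStar

/-! Up to one bit, the code length is at most the sum of the costs `-log₂` of the coding
probabilities of the bits (`length_ppmStar_le`). The first `n` sections have length of order `n * 2
^ n`, so their bits must cost `o(n * 2 ^ n)` altogether.

The prefix `S_1 ⋯ S_n` has few factors. A factor inside a block of order `m` is a window of a
sequence of period `2 ^ m`, so there are at most `2 ^ m` of them, whatever their length `l`; the at
most `n ^ 2` block boundaries add about `n ^ 2 * l` more (`card_factors_firstSecs_le`). Summed over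
consecutive lengths, the numbers of right special factors telescope to a factor count, so some `l`
between `n` and `n + n ^ 4` has only about `2 ^ n / n ^ 4` of them (`exists_card_rightSpecial_le`).

Take the last `l` bits as context. If they are not right special, the next bit is the only one that
ever follows them. PPM* starts at the shortest deterministic context, a suffix of this one that has
seen the bit at least as often; after `K` occurrences the bit costs at most `2 / K`
(`cost_le_of_deterministic`). The exceptions are few (`card_bad_le`, `card_bad_seqS_le`): a right
special context occurs only `O(n ^ 3)` times, and each of the roughly `2 ^ n` factors of length `l +
1` has a rare past at most `K` times.

An exceptional bit still costs only `O(log n)` (`cost_seqS_le`): there is at most one escape, and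
the contexts involved have occurred `O(n ^ 3)` times. The total is `O(n * 2 ^ n / K + K * 2 ^ n *
log n)`, apart from lower order terms; with `K` about `√n` the ratio is `O(log n / √n)`. -/

namespace PPMStar

/-! ### Windows and occurrences -/

/-- The factor of length `l` of the infinite sequence `a` that starts at position `i`. -/
def win (a : ℕ → Bool) (i l : ℕ) : List Bool :=
  (List.range l).map fun j => a (i + j)

@[simp] theorem length_win (a : ℕ → Bool) (i l : ℕ) : (win a i l).length = l := by simp [win]

@[simp] theorem length_initial (a : ℕ → Bool) (n : ℕ) : (initial a n).length = n := by
  simp [initial]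

theorem win_zero_left (a : ℕ → Bool) (l : ℕ) : win a 0 l = initial a l := by
  simp [win, initial]

theorem win_eq_initial (a : ℕ → Bool) (i l : ℕ) : win a i l = initial (fun j => a (i + j)) l := rfl

theorem win_eq_iff {a b : ℕ → Bool} {i k l : ℕ} :
    win a i l = win b k l ↔ ∀ j < l, a (i + j) = b (k + j) := by
  simp [win]

theorem win_add (a : ℕ → Bool) (i l m : ℕ) : win a i (l + m) = win a i l ++ win a (i + l) m := by
  simp [win, List.range_add, Function.comp_def, Nat.add_assoc]

theorem win_succ (a : ℕ → Bool) (i l : ℕ) : win a i (l + 1) = win a i l ++ [a (i + l)] := by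
  simp [win, List.range_succ]

theorem initial_add (a : ℕ → Bool) (m n : ℕ) : initial a (m + n) = initial a m ++ win a m n := by
  rw [← win_zero_left, win_add, win_zero_left, Nat.zero_add]

theorem initial_succ (a : ℕ → Bool) (n : ℕ) : initial a (n + 1) = initial a n ++ [a n] := by
  simp [initial, List.range_succ]

theorem initial_eq_append_win (a : ℕ → Bool) {i n : ℕ} (h : i ≤ n) :
    initial a n = initial a i ++ win a i (n - i) := by
  rw [← initial_add, Nat.add_sub_cancel' h]

theorem drop_initial (a : ℕ → Bool) {i n : ℕ} (h : i ≤ n) :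
    (initial a n).drop i = win a i (n - i) := by
  rw [initial_eq_append_win a h, List.drop_left' (by simp)]

theorem win_suffix_initial (a : ℕ → Bool) {l n : ℕ} (h : l ≤ n) :
    win a (n - l) l <:+ initial a n := by
  have := initial_eq_append_win a (Nat.sub_le n l)
  rw [Nat.sub_sub_self h] at this
  exact ⟨_, this.symm⟩

theorem initial_getD (x : List Bool) : initial (fun k => x.getD k false) x.length = x := by
  apply List.ext_getElem <;> simp [initial]
  intro i h
  simp [List.getElem?_eq_getElem h]

theorem prefix_win_iff (a : ℕ → Bool) (i l : ℕ) (w : List Bool) :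
    w <+: win a i l ↔ w.length ≤ l ∧ win a i w.length = w := by
  constructor
  · intro h
    have hl : w.length ≤ l := by simpa using h.length_le
    refine ⟨hl, ?_⟩
    have h1 : win a i w.length <+: win a i l := by
      conv_rhs => rw [← Nat.add_sub_cancel' hl, win_add]
      exact List.prefix_append _ _
    exact (List.prefix_of_prefix_length_le h1 h (by simp)).eq_of_length (by simp)
  · rintro ⟨hl, h⟩
    conv_rhs => rw [← Nat.add_sub_cancel' hl, win_add, h]
    exact List.prefix_append _ _

theorem tails_eq_map_drop (x : List Bool) :
    x.tails = (List.range (x.length + 1)).map fun i => x.drop i := by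
  induction x with
  | nil => simp
  | cons b x ih =>
    rw [List.tails_cons, ih, List.length_cons, List.range_succ_eq_map (n := x.length + 1)]
    simp [Function.comp_def]

theorem occ_eq_card_drop (w x : List Bool) :
    occ w x = ((Finset.range (x.length + 1)).filter fun i => w <+: x.drop i).card := by
  rw [occ, tails_eq_map_drop, List.countP_map]
  rw [Finset.card_def, Finset.filter_val, Finset.range_val, ← Multiset.coe_range,
    Multiset.filter_coe, Multiset.coe_card, List.countP_eq_length_filter]
  congr 1
  apply List.filter_congr
  intro i _
  simp only [Function.comp]
  rw [Bool.eq_iff_iff]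
  simp

theorem occ_initial (w : List Bool) (a : ℕ → Bool) (n : ℕ) :
    occ w (initial a n) =
      ((Finset.range (n + 1 - w.length)).filter fun i => win a i w.length = w).card := by
  rw [occ_eq_card_drop]
  congr 1
  ext i
  simp only [Finset.mem_filter, Finset.mem_range, length_initial]
  constructor
  · rintro ⟨h, h2⟩
    rw [drop_initial a (by omega), prefix_win_iff] at h2
    exact ⟨by omega, h2.2⟩
  · rintro ⟨h, h2⟩
    refine ⟨by omega, ?_⟩
    rw [drop_initial a (by omega), prefix_win_iff]
    exact ⟨by omega, h2⟩

theorem occ_pos_iff {w x : List Bool} : 0 < occ w x ↔ w <:+: x := by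
  rw [occ, List.countP_pos_iff]
  constructor
  · rintro ⟨y, hy, h⟩
    have hy := (List.mem_tails _ _).1 hy
    exact (List.isPrefixOf_iff_prefix.1 h).isInfix.trans hy.isInfix
  · intro h
    obtain ⟨t, ht, hs⟩ := List.infix_iff_prefix_suffix.1 h
    exact ⟨t, (List.mem_tails _ _).2 hs, List.isPrefixOf_iff_prefix.2 ht⟩

theorem occ_le_occ_of_prefix {v w : List Bool} (h : v <+: w) (x : List Bool) :
    occ w x ≤ occ v x :=
  List.countP_mono_left fun _ _ hy =>
    List.isPrefixOf_iff_prefix.2 (h.trans (List.isPrefixOf_iff_prefix.1 hy))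

theorem occ_append_le (u w x : List Bool) : occ (u ++ w) x ≤ occ w x := by
  rw [← initial_getD x, occ_initial, occ_initial]
  refine Finset.card_le_card_of_injOn (fun i => i + u.length) ?_ (fun i _ j _ h => by simpa using h)
  intro i hi
  simp only [Finset.coe_filter, Finset.mem_range, Set.mem_ofPred_eq, List.length_append] at hi ⊢
  refine ⟨by omega, ?_⟩
  rw [win_add] at hi
  exact (List.append_inj hi.2 (by simp)).2

/-- Equality can fail by the occurrence of `w` at the very end of `x`, which no bit follows. -/
theorem cnt_add_cnt_le_occ (x w : List Bool) : cnt x w false + cnt x w true ≤ occ w x := by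
  rw [cnt, cnt, occ_eq_card_drop, occ_eq_card_drop, occ_eq_card_drop,
    ← Finset.card_union_of_disjoint]
  · refine Finset.card_le_card fun i hi => ?_
    simp only [Finset.mem_union, Finset.mem_filter] at hi ⊢
    rcases hi with hi | hi <;> exact ⟨hi.1, (List.prefix_append _ _).trans hi.2⟩
  · refine Finset.disjoint_left.2 fun i hi hj => ?_
    have h := List.prefix_of_prefix_length_le (Finset.mem_filter.1 hi).2 (Finset.mem_filter.1 hj).2
      (by simp)
    simpa using h.eq_of_length (by simp)

theorem occ_append_right_le (w x y : List Bool) : occ w x ≤ occ w (x ++ y) := by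
  rw [occ_eq_card_drop, occ_eq_card_drop]
  refine Finset.card_le_card fun i hi => ?_
  simp only [Finset.mem_filter, Finset.mem_range, List.length_append] at hi ⊢
  refine ⟨by omega, ?_⟩
  rw [List.drop_append_of_le_length (by omega)]
  exact hi.2.trans (List.prefix_append _ _)

theorem occ_initial_mono (w : List Bool) (a : ℕ → Bool) {m n : ℕ} (h : m ≤ n) :
    occ w (initial a m) ≤ occ w (initial a n) := by
  rw [initial_eq_append_win a h]
  exact occ_append_right_le _ _ _

theorem occ_append_le_add (w x y : List Bool) :
    occ w (x ++ y) ≤ occ w x + occ w y + w.length := by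
  rw [occ_eq_card_drop, occ_eq_card_drop, occ_eq_card_drop]
  set A := (Finset.range (x.length + 1)).filter fun i => w <+: x.drop i
  set B := (Finset.range (y.length + 1)).filter fun i => w <+: y.drop i
  -- The last set collects the at most `w.length` starting positions of occurrences that straddle
  -- the seam.
  have hsub : ((Finset.range ((x ++ y).length + 1)).filter fun i => w <+: (x ++ y).drop i) ⊆
      (A ∪ B.image fun i => i + x.length) ∪ Finset.Ico (x.length + 1 - w.length) (x.length + 1) := by
    intro i hi
    simp only [Finset.mem_filter, Finset.mem_range, List.length_append, Finset.mem_union,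
      Finset.mem_image, Finset.mem_Ico, A, B] at hi ⊢
    by_cases h1 : i + w.length ≤ x.length
    · left; left
      refine ⟨by omega, ?_⟩
      have h2 := hi.2
      rw [List.drop_append_of_le_length (by omega)] at h2
      exact List.prefix_of_prefix_length_le h2 (List.prefix_append _ _) (by simp; omega)
    · by_cases h2 : x.length ≤ i
      · left; right
        refine ⟨i - x.length, ⟨by omega, ?_⟩, by omega⟩
        have h3 := hi.2
        rwa [List.drop_append, List.drop_eq_nil_of_le h2, List.nil_append] at h3
      · right; omega
  refine (Finset.card_le_card hsub).trans ?_
  refine (Finset.card_union_le _ _).trans ?_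
  have h1 := Finset.card_union_le A (B.image fun i => i + x.length)
  have h2 : (B.image fun i => i + x.length).card ≤ B.card := Finset.card_image_le
  simp only [Nat.card_Ico]
  omega

/-- Each seam costs at most `w.length` straddling occurrences; the final 1 is for the empty string,
which occurs once in the empty list. -/
theorem occ_flatten_le (w : List Bool) (c : ℕ) (l : List (List Bool))
    (h : ∀ y ∈ l, occ w y ≤ c) : occ w l.flatten ≤ l.length * (c + w.length) + 1 := by
  induction l with
  | nil =>
    simp only [List.flatten_nil, List.length_nil, Nat.zero_mul, Nat.zero_add]
    exact List.countP_le_length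
  | cons y l ih =>
    rw [List.flatten_cons, List.length_cons]
    have h1 := occ_append_le_add w y l.flatten
    have h2 := ih fun z hz => h z (List.mem_cons_of_mem _ hz)
    have h3 := h y List.mem_cons_self
    nlinarith

theorem occ_initial_succ_of_win {w : List Bool} {a : ℕ → Bool} {i : ℕ}
    (h : win a i w.length = w) :
    occ w (initial a (i + w.length)) = occ w (initial a (i + w.length - 1)) + 1 ∨ w = [] := by
  by_cases hw : w = []
  · exact Or.inr hw
  left
  have hl : 0 < w.length := List.length_pos_iff.2 hw
  rw [occ_initial, occ_initial, show i + w.length + 1 - w.length = i + 1 by omega,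
    show i + w.length - 1 + 1 - w.length = i by omega, Finset.range_add_one,
    Finset.filter_insert, if_pos h, Finset.card_insert_of_notMem (by simp)]

/-! ### Coding probabilities -/

/-- The factor by which the current interval shrinks when the bit `b` is encoded after `x` with the
list `ws` of contexts. -/
def chainProb (x : List Bool) (b : Bool) : List (List Bool) → ℚ
  | [] => 1 / 2
  | w :: ws =>
    if 0 < cnt x w b then (cnt x w b : ℚ) / total x w
    else (escCnt x w : ℚ) / total x w * chainProb x b ws

/-- The probability with which the bit `b` is encoded after `x`. -/
def bitProb (x : List Bool) (b : Bool) : ℚ := chainProb x b (contextChain x)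

theorem encodeBit_snd (x : List Bool) (b : Bool) (ws : List (List Bool)) (I : ℚ × ℚ) :
    (encodeBit x b ws I).2 = I.2 * chainProb x b ws := by
  induction ws generalizing I with
  | nil => simp [encodeBit, narrow, chainProb]
  | cons w ws ih =>
    rw [encodeBit, chainProb]
    by_cases h : 0 < cnt x w b
    · simp [h, narrow]
    · rw [if_neg h, if_neg h, ih]; simp [narrow, mul_assoc]

theorem encodeFrom_append (x y z : List Bool) (I : ℚ × ℚ) :
    encodeFrom x I (y ++ z) = encodeFrom (x ++ y) (encodeFrom x I y) z := by
  induction y generalizing x I with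
  | nil => simp [encodeFrom]
  | cons b y ih => simp [encodeFrom, ih]

theorem finalInterval_snd (S : ℕ → Bool) (n : ℕ) :
    (finalInterval (initial S n)).2 =
      ∏ p ∈ Finset.range n, bitProb (initial S p) (S p) := by
  induction n with
  | zero => simp [finalInterval, initial, encodeFrom]
  | succ n ih =>
    rw [initial_succ, finalInterval, encodeFrom_append, Finset.prod_range_succ, ← ih]
    simp [encodeFrom, encodeBit_snd, bitProb, finalInterval]

theorem filter_tails_length_le (u w : List Bool) :
    (u ++ w).tails.filter (fun v => v.length ≤ w.length) = w.tails := by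
  induction u with
  | nil =>
    simp only [List.nil_append, List.filter_eq_self, List.mem_tails, decide_eq_true_eq]
    exact fun v hv => hv.length_le
  | cons b u ih =>
    rw [List.cons_append, List.tails_cons, List.filter_cons_of_neg, ih]
    simp

theorem mem_relevant {x w : List Bool} : w ∈ relevant x ↔ w <:+ x ∧ InModel x w := by
  simp [relevant]

theorem contextChain_of_startContext {x w : List Bool} (h : startContext x = some w)
    (hw : w <:+ x) : contextChain x = w.tails.filter fun v => InModel x v := by
  obtain ⟨u, rfl⟩ := hw
  rw [contextChain, h]
  simp only [relevant]
  rw [List.filter_filter, ← filter_tails_length_le u w, List.filter_filter]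
  simp [Bool.and_comm]

theorem escCnt_eq_one_iff {x w : List Bool} :
    escCnt x w = 1 ↔ ∃ b, cnt x w b = 0 ∧ 0 < cnt x w (!b) := by
  rw [escCnt]
  constructor
  · split_ifs with h1 h2 <;> intro h <;> first | omega | skip
    · exact ⟨true, by omega, h1⟩
    · exact ⟨false, by omega, by simpa⟩
  · rintro ⟨b | b, h0, h1⟩ <;> simp_all

theorem escCnt_le_two (x w : List Bool) : escCnt x w ≤ 2 := by
  rw [escCnt]; split_ifs <;> omega

theorem cnt_pos_of_escCnt_eq_two {x w : List Bool} (h : escCnt x w = 2) (b : Bool) :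
    0 < cnt x w b := by
  rw [escCnt] at h
  cases b <;> split_ifs at h <;> first | assumption | omega

theorem escCnt_eq_two {x w : List Bool} (h : ∀ b, 0 < cnt x w b) : escCnt x w = 2 := by
  simp [escCnt, h]

theorem escCnt_pos_iff {x w : List Bool} : 0 < escCnt x w ↔ ∃ b, 0 < cnt x w b := by
  rw [escCnt]
  constructor
  · intro h
    by_contra! hc
    have h1 := hc true
    have h2 := hc false
    rw [if_neg (by omega), if_neg (by omega)] at h
    omega
  · rintro ⟨b | b, h⟩ <;> simp [h]

theorem cnt_le_cnt_of_suffix {v w : List Bool} (h : v <:+ w) (x : List Bool) (b : Bool) :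
    cnt x w b ≤ cnt x v b := by
  obtain ⟨u, rfl⟩ := h
  rw [cnt, cnt, List.append_assoc]
  exact occ_append_le _ _ _

/-- Shortening a context on the left only increases its counts. Hence the contexts below a relevant
one have no gaps, and an escape shortens the context by exactly one bit. -/
theorem InModel.of_suffix {x v w : List Bool} (hw : InModel x w) (h : v <:+ w) :
    InModel x v := by
  refine ⟨?_, ?_⟩
  · obtain ⟨b, hb⟩ := escCnt_pos_iff.1 hw.1
    exact escCnt_pos_iff.2 ⟨b, hb.trans_le (cnt_le_cnt_of_suffix h x b)⟩
  · by_cases hv : v = []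
    · exact Or.inl hv
    · right
      obtain ⟨u, rfl⟩ := h
      rcases hw.2 with h2 | h2
      · simp at h2; exact absurd h2.2 hv
      · rw [List.dropLast_append_of_ne_nil hv] at h2
        exact h2.trans (occ_append_le _ _ _)

theorem chain_eq_cons {x w : List Bool} (hw : InModel x w) :
    ∃ ws, (w.tails.filter fun v => InModel x v) = w :: ws := by
  cases w with
  | nil => simp [hw]
  | cons b w => rw [List.tails_cons, List.filter_cons_of_pos (by simpa using hw)]; simp

theorem pairwise_tails (x : List Bool) : x.tails.Pairwise fun u v => v.length < u.length := by
  induction x with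
  | nil => simp
  | cons b x ih =>
    rw [List.tails_cons, List.pairwise_cons]
    refine ⟨fun v hv => ?_, ih⟩
    have := ((List.mem_tails _ _).1 hv).length_le
    simp; omega

theorem pairwise_relevant (x : List Bool) :
    (relevant x).Pairwise fun u v => v.length < u.length :=
  (pairwise_tails x).filter _

theorem startContext_of_exists {x w : List Bool} (hw : w ∈ relevant x) (h1 : escCnt x w = 1) :
    ∃ v, startContext x = some v ∧ v ∈ relevant x ∧ escCnt x v = 1 ∧
      ∀ u ∈ relevant x, escCnt x u = 1 → v.length ≤ u.length := by
  obtain ⟨v, hv⟩ : ∃ v, (relevant x).reverse.find? (fun w => escCnt x w = 1) = some v := by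
    rw [← Option.isSome_iff_exists, List.find?_isSome]
    exact ⟨w, by simpa using hw, by simpa using h1⟩
  refine ⟨v, by rw [startContext, hv], by simpa using List.mem_of_find?_eq_some hv,
    by simpa using List.find?_some hv, fun u hu hu1 => ?_⟩
  obtain ⟨-, as, bs, hab, hno⟩ := List.find?_eq_some_iff_append.1 hv
  have hp : (relevant x).reverse.Pairwise fun u v => u.length < v.length :=
    List.pairwise_reverse.2 (pairwise_relevant x)
  have hu' : u ∈ (relevant x).reverse := by simpa using hu
  rw [hab] at hp hu'
  rcases List.mem_append.1 hu' with h | h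
  · have := hno u h
    simp [hu1] at this
  · rcases List.mem_cons.1 h with rfl | h
    · exact le_rfl
    · exact ((List.pairwise_cons.1 (List.pairwise_append.1 hp).2.1).1 u h).le

theorem startContext_of_forall {x : List Bool} (h : ∀ w ∈ relevant x, escCnt x w ≠ 1)
    {w : List Bool} (hw : w ∈ relevant x) :
    ∃ v, startContext x = some v ∧ v ∈ relevant x ∧ ∀ u ∈ relevant x, u.length ≤ v.length := by
  have hf : (relevant x).reverse.find? (fun w => escCnt x w = 1) = none := by
    rw [List.find?_eq_none]
    intro u hu
    simpa using h u (by simpa using hu)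
  have hp := pairwise_relevant x
  rw [startContext, hf]
  cases hr : relevant x with
  | nil => rw [hr] at hw; simp at hw
  | cons v l =>
    rw [hr] at hp
    refine ⟨v, rfl, List.mem_cons_self, fun u hu => ?_⟩
    rcases List.mem_cons.1 hu with rfl | hu
    · exact le_rfl
    · exact ((List.pairwise_cons.1 hp).1 u hu).le

theorem chainProb_pos (x : List Bool) (b : Bool) (ws : List (List Bool))
    (h : ∀ w ∈ ws, InModel x w) : 0 < chainProb x b ws := by
  induction ws with
  | nil => simp [chainProb]
  | cons w ws ih =>
    have he := (h w List.mem_cons_self).1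
    have ht : (0 : ℚ) < total x w := by
      rw [total]; exact_mod_cast (by omega)
    rw [chainProb]
    split_ifs with hc
    · have : (0 : ℚ) < cnt x w b := by exact_mod_cast hc
      positivity
    · have := ih fun v hv => h v (List.mem_cons_of_mem _ hv)
      have : (0 : ℚ) < escCnt x w := by exact_mod_cast he
      positivity

theorem bitProb_pos (x : List Bool) (b : Bool) : 0 < bitProb x b := by
  refine chainProb_pos x b _ fun w hw => ?_
  rw [contextChain] at hw
  split at hw
  · exact (mem_relevant.1 (List.mem_filter.1 hw).1).2
  · simp at hw

/-- A bit that has always followed some suffix of `x`, and at least `K` times, is encoded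
with probability at least `K / (K + 1)`. -/
theorem bitProb_ge_of_deterministic {x w : List Bool} {b : Bool} {K : ℕ} (hK : 2 ≤ K)
    (hw : w <:+ x) (h0 : cnt x w (!b) = 0) (h1 : K ≤ cnt x w b) :
    (K : ℚ) / (K + 1) ≤ bitProb x b := by
  have hesc : escCnt x w = 1 := escCnt_eq_one_iff.2 ⟨!b, h0, by simp; omega⟩
  have hocc : K ≤ occ w x := h1.trans (occ_le_occ_of_prefix (List.prefix_append _ _) x)
  have hmod : InModel x w := ⟨by omega, Or.inr (hK.trans (hocc.trans
    (occ_le_occ_of_prefix (List.dropLast_prefix w) x)))⟩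
  have hrel : w ∈ relevant x := mem_relevant.2 ⟨hw, hmod⟩
  obtain ⟨v, hv, hvr, hv1, hmin⟩ := startContext_of_exists hrel hesc
  obtain ⟨hvx, hvm⟩ := mem_relevant.1 hvr
  -- By minimality the start context is a suffix of `w`, so it inherits the count `K` of `b`; being
  -- deterministic, it predicts `b` alone, and no escape is sent.
  have hvw : v <:+ w := List.suffix_of_suffix_length_le hvx hw (hmin w hrel hesc)
  obtain ⟨ws, hws⟩ := chain_eq_cons hvm
  rw [bitProb, contextChain_of_startContext hv hvx, hws, chainProb]
  have hvK : K ≤ cnt x v b := h1.trans (cnt_le_cnt_of_suffix hvw x b)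
  have hv0 : cnt x v (!b) = 0 := by
    obtain ⟨c, hc0, hc1⟩ := escCnt_eq_one_iff.1 hv1
    cases b <;> cases c <;> simp at * <;> omega
  rw [if_pos (by omega)]
  have ht : total x v = cnt x v b + 1 := by
    rw [total, hv1]; cases b <;> simp at * <;> omega
  rw [ht]
  have h3 : (K : ℚ) ≤ cnt x v b := by exact_mod_cast hvK
  push_cast
  rw [div_le_div_iff₀ (by positivity) (by positivity)]
  nlinarith

/-- If both bits have followed `w`, then each of them has probability at least `1 / (C + 2)` in
the context `w`, where `C` bounds the number of occurrences of `w`. -/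
theorem chainProb_ge_of_escCnt_eq_two {x w : List Bool} (h2 : escCnt x w = 2) {C : ℕ}
    (hC : occ w x ≤ C) (b : Bool) (ws : List (List Bool)) :
    (1 : ℚ) / (C + 2) ≤ chainProb x b (w :: ws) := by
  have hb := cnt_pos_of_escCnt_eq_two h2 b
  rw [chainProb, if_pos hb, total, h2]
  have h := (cnt_add_cnt_le_occ x w).trans hC
  have h3 : ((cnt x w false + cnt x w true + 2 : ℕ) : ℚ) ≤ C + 2 := by exact_mod_cast (by omega)
  have h4 : (1 : ℚ) ≤ cnt x w b := by exact_mod_cast hb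
  have h5 : (0 : ℚ) < ((cnt x w false + cnt x w true + 2 : ℕ) : ℚ) := by positivity
  exact div_le_div₀ (by positivity) h4 h5 h3

/-- If every string of length at most `r` has been followed by both bits and every string of
length `r` occurs at most `C` times, then each bit has probability at least `1 / (C + 2) ^ 2`. -/
theorem bitProb_ge {x : List Bool} {r C : ℕ} (hr : r ≤ x.length)
    (h2 : ∀ v : List Bool, v.length ≤ r → escCnt x v = 2)
    (hC : ∀ v : List Bool, v.length = r → occ v x ≤ C) (b : Bool) :
    (1 : ℚ) / (C + 2) ^ 2 ≤ bitProb x b := by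
  have hC' : ∀ v : List Bool, r ≤ v.length → occ v x ≤ C := fun v hv =>
    (occ_le_occ_of_prefix (List.take_prefix r v) x).trans (hC _ (by simpa using hv))
  have hC0 : (0 : ℚ) ≤ C := by positivity
  have hocc2 : ∀ v : List Bool, v.length ≤ r → 2 ≤ occ v x := fun v hv => by
    have := cnt_pos_of_escCnt_eq_two (h2 v hv) true
    have := cnt_pos_of_escCnt_eq_two (h2 v hv) false
    have := cnt_add_cnt_le_occ x v
    omega
  have hrel : x.drop (x.length - r) ∈ relevant x := by
    have hl : (x.drop (x.length - r)).length = r := by simp; omega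
    refine mem_relevant.2 ⟨List.drop_suffix _ _, by rw [h2 _ hl.le]; omega, Or.inr ?_⟩
    exact hocc2 _ (by simp; omega)
  by_cases hdet : ∃ w ∈ relevant x, escCnt x w = 1
  · obtain ⟨w, hw, hw1⟩ := hdet
    obtain ⟨v, hv, hvr, hv1, hmin⟩ := startContext_of_exists hw hw1
    obtain ⟨hvx, hvm⟩ := mem_relevant.1 hvr
    have hvl : r < v.length := by
      by_contra! hc
      have := h2 v hc; omega
    rw [bitProb, contextChain_of_startContext hv hvx]
    -- One bit below the shortest deterministic context both bits have been seen, so at most one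
    -- escape is sent: one factor `1 / (C + 2)` bounds the escape, the other the bit.
    obtain ⟨c, u, rfl⟩ := List.exists_cons_of_length_pos (by omega : 0 < v.length)
    rw [List.tails_cons, List.filter_cons_of_pos (by simpa using hvm)]
    have hum : InModel x u := hvm.of_suffix (List.suffix_cons c u)
    have hu2 : escCnt x u = 2 := by
      have h1 := hum.1
      have h3 := escCnt_le_two x u
      by_contra hne
      have := hmin u (mem_relevant.2 ⟨(List.suffix_cons c u).trans hvx, hum⟩) (by omega)
      simp at this
    obtain ⟨ws, hws⟩ := chain_eq_cons hum
    rw [hws]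
    have hnext := chainProb_ge_of_escCnt_eq_two hu2 (hC' u (by simpa using hvl)) b ws
    rw [chainProb]
    have htot : ((total x (c :: u) : ℕ) : ℚ) ≤ C + 2 := by
      have := (cnt_add_cnt_le_occ x (c :: u)).trans (hC' (c :: u) (by omega))
      rw [total, hv1]; exact_mod_cast (by omega)
    have htot0 : (0 : ℚ) < total x (c :: u) := by
      rw [total, hv1]; exact_mod_cast (by omega)
    have hsq : (1 : ℚ) / (C + 2) ^ 2 = 1 / (C + 2) * (1 / (C + 2)) := by
      field_simp
    rw [hsq]
    split_ifs with hc
    · have h4 : (1 : ℚ) ≤ cnt x (c :: u) b := by exact_mod_cast hc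
      calc (1 : ℚ) / (C + 2) * (1 / (C + 2)) ≤ 1 / (C + 2) * 1 := by
            gcongr
            rw [div_le_one (by positivity)]; linarith
        _ ≤ _ := by rw [mul_one]; exact div_le_div₀ (by positivity) h4 htot0 htot
    · rw [hv1, Nat.cast_one]
      exact mul_le_mul (one_div_le_one_div_of_le htot0 htot) hnext (by positivity) (by positivity)
  -- Coding now starts in the longest relevant context, which has length at least `r` and predicts
  -- both bits.
  · push Not at hdet
    obtain ⟨v, hv, hvr, hmax⟩ := startContext_of_forall hdet hrel
    obtain ⟨hvx, hvm⟩ := mem_relevant.1 hvr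
    have hvl : r ≤ v.length := by
      have := hmax _ hrel
      simp at this; omega
    have hv2 : escCnt x v = 2 := by
      have h1 := hvm.1
      have h3 := escCnt_le_two x v
      have := hdet v hvr
      omega
    obtain ⟨ws, hws⟩ := chain_eq_cons hvm
    rw [bitProb, contextChain_of_startContext hv hvx, hws]
    refine le_trans ?_ (chainProb_ge_of_escCnt_eq_two hv2 (hC' v hvl) b ws)
    gcongr
    nlinarith

/-! ### Existence of de Bruijn strings -/

/-- The word that differs from `v` in the first bit only. -/
def conj {k : ℕ} (v : Fin (k + 1) → Bool) : Fin (k + 1) → Bool := Fin.cons (!v 0) (Fin.tail v)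

/-- A permutation of the words of length `k + 1` that maps each word to its shift by one bit, with
some new last bit. -/
def IsShift {k : ℕ} (σ : Equiv.Perm (Fin (k + 1) → Bool)) : Prop :=
  ∀ v, Fin.init (σ v) = Fin.tail v

theorem exists_isShift (k : ℕ) : ∃ σ : Equiv.Perm (Fin (k + 1) → Bool), IsShift σ := by
  refine ⟨(finRotate (k + 1)).symm.arrowCongr (Equiv.refl _), fun v => ?_⟩
  ext i
  simp [Fin.init, Fin.tail, Equiv.arrowCongr]

theorem tail_conj {k : ℕ} (v : Fin (k + 1) → Bool) : Fin.tail (conj v) = Fin.tail v := by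
  simp [conj]

theorem conj_ne {k : ℕ} (v : Fin (k + 1) → Bool) : conj v ≠ v := fun h => by
  have := congrFun h 0
  simp [conj] at this

/-- The two exchanged words have the same tail, and being a shift depends only on the tail. -/
theorem IsShift.mul_swap {k : ℕ} {σ : Equiv.Perm (Fin (k + 1) → Bool)} (h : IsShift σ)
    (v : Fin (k + 1) → Bool) : IsShift (σ * Equiv.swap v (conj v)) := by
  intro u
  rw [Equiv.Perm.mul_apply, h]
  by_cases h1 : u = v
  · rw [h1, Equiv.swap_apply_left, tail_conj]
  · by_cases h2 : u = conj v
    · rw [h2, Equiv.swap_apply_right, tail_conj]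
    · rw [Equiv.swap_apply_of_ne_of_ne h1 h2]

/-- Composing with a transposition of two points on different cycles joins the cycles. -/
theorem sameCycle_mul_swap {α : Type*} [Finite α] [DecidableEq α] {σ : Equiv.Perm α} {v w u : α}
    (hw : ¬ σ.SameCycle v w) (hu : σ.SameCycle v u) :
    (σ * Equiv.swap v w).SameCycle w u := by
  have hσ : (σ * Equiv.swap v w) w = σ v := by simp
  -- From `w` the new permutation jumps to `σ v` and then follows the old cycle of `v`, which avoids
  -- `w`, until it is back at `v`.
  have key : ∀ i : ℕ, (σ * Equiv.swap v w).SameCycle w ((σ ^ (i + 1)) v) := by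
    intro i
    induction i with
    | zero => rw [zero_add, pow_one, ← hσ]; exact Equiv.Perm.sameCycle_apply_right.2 (.refl _ _)
    | succ i ih =>
      by_cases h1 : (σ ^ (i + 1)) v = v
      · rw [pow_succ', Equiv.Perm.mul_apply, h1, ← hσ]
        exact Equiv.Perm.sameCycle_apply_right.2 (.refl _ _)
      · have h2 : (σ ^ (i + 1)) v ≠ w := fun h => hw ⟨(i + 1 : ℕ), by rw [zpow_natCast, h]⟩
        have h3 : (σ * Equiv.swap v w) ((σ ^ (i + 1)) v) = (σ ^ (i + 1 + 1)) v := by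
          rw [Equiv.Perm.mul_apply, Equiv.swap_apply_of_ne_of_ne h1 h2, pow_succ' σ (i + 1),
            Equiv.Perm.mul_apply]
        rw [← h3]
        exact Equiv.Perm.sameCycle_apply_right.2 ih
  obtain ⟨i, hi0, -, rfl⟩ := hu.exists_pow_eq''
  obtain ⟨i, rfl⟩ := Nat.exists_eq_succ_of_ne_zero hi0.ne'
  exact key i

/-- Among the shift permutations take one whose cycle through the zero word is largest. If it
contained `v` but not `conj v`, the transposition of the two would join another cycle to it. So it
is closed under `conj`, hence under dropping the first bit and appending either bit, and `k + 1`
such steps reach every word. -/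
theorem exists_isShift_sameCycle (k : ℕ) :
    ∃ σ : Equiv.Perm (Fin (k + 1) → Bool), IsShift σ ∧ ∀ u v, σ.SameCycle u v := by
  obtain ⟨σ₀, hσ₀⟩ := exists_isShift k
  let z : Fin (k + 1) → Bool := fun _ => false
  obtain ⟨σ, hσ, hmax⟩ := Set.Finite.exists_maximalFor
    (fun σ : Equiv.Perm (Fin (k + 1) → Bool) => (Finset.univ.filter fun u => σ.SameCycle z u).card)
    {σ | IsShift σ} (Set.toFinite _) ⟨σ₀, hσ₀⟩
  refine ⟨σ, hσ, ?_⟩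
  have hconj : ∀ v, σ.SameCycle z v → σ.SameCycle z (conj v) := by
    intro v hv
    by_contra hc
    have hvw : ¬ σ.SameCycle v (conj v) := fun h => hc (hv.trans h)
    have hsub : (Finset.univ.filter fun u => σ.SameCycle z u) ⊂
        (Finset.univ.filter fun u => (σ * Equiv.swap v (conj v)).SameCycle z u) := by
      have hz := sameCycle_mul_swap hvw hv.symm
      refine (Finset.ssubset_iff_of_subset fun u hu => ?_).2 ⟨conj v, ?_, ?_⟩
      · simp only [Finset.mem_filter, Finset.mem_univ, true_and] at hu ⊢
        exact hz.symm.trans (sameCycle_mul_swap hvw (hv.symm.trans hu))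
      · simpa using hz.symm
      · simpa using hc
    have := Finset.card_lt_card hsub
    have h2 := hmax (hσ.mul_swap v) this.le
    simp only at h2
    omega
  have hsnoc : ∀ v b, σ.SameCycle z v → σ.SameCycle z (Fin.snoc (Fin.tail v) b) := by
    intro v b hv
    have h1 : σ.SameCycle z (σ v) := Equiv.Perm.sameCycle_apply_right.2 hv
    have h2 : σ.SameCycle z (σ (conj v)) := Equiv.Perm.sameCycle_apply_right.2 (hconj v hv)
    have e1 : σ v = Fin.snoc (Fin.tail v) (σ v (Fin.last k)) := by
      rw [← hσ v, Fin.snoc_init_self]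
    have e2 : σ (conj v) = Fin.snoc (Fin.tail v) (σ (conj v) (Fin.last k)) := by
      rw [← tail_conj v, ← hσ (conj v), Fin.snoc_init_self]
    by_cases hb : σ v (Fin.last k) = b
    · rwa [e1, hb] at h1
    · by_cases hb2 : σ (conj v) (Fin.last k) = b
      · rwa [e2, hb2] at h2
      · exfalso
        apply conj_ne v
        apply σ.injective
        rw [e1, e2]
        congr 1
        revert hb hb2
        cases σ v (Fin.last k) <;> cases σ (conj v) (Fin.last k) <;> cases b <;> simp
  have hall : ∀ u, σ.SameCycle z u := by
    intro u
    -- After `j` steps the last `j` bits of `v` are the first `j` bits of `u`.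
    have key : ∀ j ≤ k + 1, ∃ v, σ.SameCycle z v ∧
        ∀ i : ℕ, ∀ h : i < j, ∀ h1 : i < k + 1, ∀ h2 : k + 1 - j + i < k + 1,
          v ⟨k + 1 - j + i, h2⟩ = u ⟨i, h1⟩ := by
      intro j
      induction j with
      | zero => exact fun _ => ⟨z, .refl _ _, by simp⟩
      | succ j ih =>
        intro hj
        obtain ⟨v, hv, hvu⟩ := ih (by omega)
        refine ⟨Fin.snoc (Fin.tail v) (u ⟨j, by omega⟩), hsnoc v _ hv, fun i h h1 h2 => ?_⟩
        by_cases hij : i = j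
        · subst hij
          have : (⟨k + 1 - (i + 1) + i, h2⟩ : Fin (k + 1)) = Fin.last k := by
            ext; simp; omega
          rw [this, Fin.snoc_last]
        · have : (⟨k + 1 - (j + 1) + i, h2⟩ : Fin (k + 1)) =
              Fin.castSucc ⟨k + 1 - (j + 1) + i, by omega⟩ := by ext; simp
          rw [this, Fin.snoc_castSucc, Fin.tail, ← hvu i (by omega) h1 (by omega)]
          congr 1
          ext; simp; omega
    obtain ⟨v, hv, hvu⟩ := key (k + 1) le_rfl
    have : v = u := by
      ext i
      have := hvu i i.2 i.2 (by omega)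
      simpa using this
    rwa [← this]
  exact fun u v => (hall u).symm.trans (hall v)

theorem initial_add_of_periodic {a : ℕ → Bool} {N : ℕ} (ha : ∀ i, a (i + N) = a i) (m : ℕ) :
    initial a (N + m) = initial a N ++ initial a m := by
  rw [initial_add, win_eq_initial]
  simp only [Nat.add_comm N, ha]

theorem take_initial (a : ℕ → Bool) {m n : ℕ} (h : m ≤ n) : (initial a n).take m = initial a m := by
  rw [initial_eq_append_win a h, List.take_left' (by simp)]

/-- An `N`-periodic sequence, `N = 2 ^ m`, comes from a de Bruijn string if and only if each string
of length `m` is read at exactly one position of the period. -/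
theorem isDeBruijn_initial_iff {a : ℕ → Bool} {m : ℕ} (hm0 : 0 < m)
    (ha : ∀ i, a (i + 2 ^ m) = a i) :
    IsDeBruijn m (initial a (2 ^ m)) ↔ ∀ w : List Bool, w.length = m →
      ((Finset.range (2 ^ m)).filter fun i => win a i m = w).card = 1 := by
  have hm : m < 2 ^ m := Nat.lt_two_pow_self
  rw [IsDeBruijn, take_initial a (by omega), ← initial_add_of_periodic ha]
  simp only [length_initial, true_and]
  refine forall₂_congr fun w hw => ?_
  subst hw
  rw [occ_initial, show 2 ^ w.length + (w.length - 1) + 1 - w.length = 2 ^ w.length by omega]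

/-- The first bits of the words along a single cycle of a shift permutation spell a de Bruijn
string: the word at time `i` is the window at position `i`. -/
theorem exists_isDeBruijn (k : ℕ) : ∃ x, IsDeBruijn (k + 1) x := by
  classical
  obtain ⟨σ, hσ, hcyc⟩ := exists_isShift_sameCycle k
  let z : Fin (k + 1) → Bool := fun _ => false
  have hcard : Fintype.card (Fin (k + 1) → Bool) = 2 ^ (k + 1) := by simp
  have hsurj : ∀ u, ∃ i < 2 ^ (k + 1), (σ ^ i) z = u := by
    intro u
    have hon : σ.IsCycleOn ((Finset.univ : Finset (Fin (k + 1) → Bool)) : Set _) :=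
      ⟨by simp, fun u _ v _ => hcyc u v⟩
    obtain ⟨i, hi, h⟩ := hon.exists_pow_eq (Finset.mem_univ z) (Finset.mem_univ u)
    exact ⟨i, by rwa [Finset.card_univ, hcard] at hi, h⟩
  have himg : (Finset.range (2 ^ (k + 1))).image (fun i => (σ ^ i) z) = Finset.univ := by
    ext u
    simp [hsurj u]
  have hinj : Set.InjOn (fun i : ℕ => (σ ^ i) z) (Finset.range (2 ^ (k + 1))) := by
    rw [← Finset.card_image_iff, himg, Finset.card_univ, hcard, Finset.card_range]
  -- The first `2 ^ (k + 1)` iterates are distinct and exhaust all words; a return to a later one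
  -- than `z` would, after cancelling, make two of them equal.
  have hper : (σ ^ (2 ^ (k + 1))) z = z := by
    obtain ⟨i, hi, h⟩ := hsurj ((σ ^ (2 ^ (k + 1))) z)
    by_cases hi0 : i = 0
    · subst hi0; simpa using h.symm
    · exfalso
      have h1 : (σ ^ (2 ^ (k + 1) - i)) z = (σ ^ 0) z := by
        apply (σ ^ i).injective
        rw [← Equiv.Perm.mul_apply, ← pow_add, Nat.add_sub_cancel' hi.le]
        simpa using h.symm
      have := hinj (by simp; omega) (by simp) h1
      omega
  let a : ℕ → Bool := fun i => (σ ^ i) z 0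
  have ha : ∀ i, a (i + 2 ^ (k + 1)) = a i := by
    intro i
    simp only [a, pow_add σ, Equiv.Perm.mul_apply, hper]
  have hread : ∀ j (hj : j < k + 1) i, (σ ^ i) z ⟨j, hj⟩ = a (i + j) := by
    intro j
    induction j with
    | zero => intro _ i; rfl
    | succ j ih =>
      intro hj i
      have h := congrFun (hσ ((σ ^ i) z)) ⟨j, by omega⟩
      simp only [Fin.init, Fin.tail, Fin.castSucc_mk, Fin.succ_mk] at h
      rw [← h, ← Equiv.Perm.mul_apply, ← pow_succ', ih (by omega)]
      congr 1
      omega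
  refine ⟨initial a (2 ^ (k + 1)), (isDeBruijn_initial_iff k.succ_pos ha).2 fun w hw => ?_⟩
  obtain ⟨i, hi, h⟩ := hsurj fun j => w[j]
  have hwin : ∀ p, win a p (k + 1) = w ↔ (σ ^ p) z = fun j => w[j] := by
    intro p
    constructor
    · intro h
      ext j
      rw [hread j j.2 p]
      simp [← h, win]
    · intro h
      apply List.ext_getElem (by simp [hw])
      intro j h1 h2
      have h3 : j < k + 1 := by simpa using h1
      have := congrFun h ⟨j, h3⟩
      simp only [win, List.getElem_map, List.getElem_range]
      rw [← hread j h3 p, this]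
      rfl
  rw [Finset.card_eq_one]
  refine ⟨i, ?_⟩
  ext p
  simp only [Finset.mem_filter, Finset.mem_range, Finset.mem_singleton, hwin]
  constructor
  · rintro ⟨h1, h2⟩
    exact hinj (by simpa using h1) (by simpa using hi) (h2.trans h.symm)
  · rintro rfl
    exact ⟨hi, h⟩

/-! ### The sections of the sequence -/

/-- The de Bruijn string of order `m`, continued periodically. -/
noncomputable def dbPer (m : ℕ) (j : ℕ) : Bool := (db m).getD (j % 2 ^ m) false

theorem dbPer_periodic (m i : ℕ) : dbPer m (i + 2 ^ m) = dbPer m i := by simp [dbPer]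

theorem dbPer_mod (m i : ℕ) : dbPer m (i % 2 ^ m) = dbPer m i := by simp [dbPer]

theorem isDeBruijn_db {m : ℕ} (hm : 0 < m) : IsDeBruijn m (db m) := by
  obtain ⟨k, rfl⟩ := Nat.exists_eq_succ_of_ne_zero hm.ne'
  have h : {x : List Bool | IsDeBruijn (k + 1) x}.Nonempty := exists_isDeBruijn k
  rw [db, dif_pos h]
  exact WellFounded.min_mem _ _ h

theorem initial_dbPer {m : ℕ} (hm : 0 < m) : initial (dbPer m) (2 ^ m) = db m := by
  have h := (isDeBruijn_db hm).1
  conv_rhs => rw [← initial_getD (db m), h]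
  refine List.map_congr_left fun j hj => ?_
  rw [dbPer, Nat.mod_eq_of_lt (by simpa using hj)]

theorem card_win_dbPer_eq_one {m : ℕ} (hm : 0 < m) {w : List Bool} (hw : w.length = m) :
    ((Finset.range (2 ^ m)).filter fun i => win (dbPer m) i m = w).card = 1 := by
  refine (isDeBruijn_initial_iff hm (dbPer_periodic m)).1 ?_ w hw
  rw [initial_dbPer hm]
  exact isDeBruijn_db hm

theorem win_dbPer_injOn {m : ℕ} (hm : 0 < m) {i j : ℕ} (hi : i < 2 ^ m) (hj : j < 2 ^ m)
    (h : win (dbPer m) i m = win (dbPer m) j m) : i = j :=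
  Finset.card_le_one.1 (card_win_dbPer_eq_one hm (length_win (dbPer m) i m)).le i
    (by simpa using hi) j (by simpa using ⟨hj, h.symm⟩)

theorem win_dbPer_mod (m i l : ℕ) : win (dbPer m) (i % 2 ^ m) l = win (dbPer m) i l := by
  rw [win_eq_iff]
  intro j _
  rw [← dbPer_mod, ← dbPer_mod m (i + j), Nat.mod_add_mod]

theorem exists_win_dbPer_eq {m : ℕ} (hm : 0 < m) {w : List Bool} (hw : w.length = m) :
    ∃ i < 2 ^ m, win (dbPer m) i m = w := by
  obtain ⟨i, hi⟩ := Finset.card_pos.1 (card_win_dbPer_eq_one hm hw ▸ Nat.one_pos)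
  exact ⟨i, by simpa using hi⟩

/-- An occurrence of `w` is determined by the `m - w.length` bits after it, because a window of
length `m` occurs once per period. -/
theorem card_win_dbPer_le {m : ℕ} (hm : 0 < m) {w : List Bool} (hw : w.length ≤ m) :
    ((Finset.range (2 ^ m)).filter fun i => win (dbPer m) i w.length = w).card ≤
      2 ^ (m - w.length) := by
  have hcard : (Finset.univ : Finset (Fin (m - w.length) → Bool)).card = 2 ^ (m - w.length) := by
    simp
  rw [← hcard]
  refine Finset.card_le_card_of_injOn (fun i j => dbPer m (i + w.length + j)) (by simp) ?_
  intro i hi j hj h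
  simp only [Finset.coe_filter, Finset.mem_range, Set.mem_ofPred_eq] at hi hj
  refine win_dbPer_injOn hm hi.1 hj.1 ?_
  have h1 : win (dbPer m) (i + w.length) (m - w.length) =
      win (dbPer m) (j + w.length) (m - w.length) := by
    rw [win_eq_iff]
    exact fun k hk => congrFun h ⟨k, hk⟩
  have hsplit : ∀ p, win (dbPer m) p m =
      win (dbPer m) p w.length ++ win (dbPer m) (p + w.length) (m - w.length) := fun p => by
    rw [← win_add, Nat.add_sub_cancel' hw]
  rw [hsplit, hsplit, hi.2, hj.2, h1]

/-- A word at most 3 bits shorter than the order occurs at most `2 ^ 3` times per period; a word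
longer than the order is cut to its prefix of length `m`. -/
theorem occ_win_dbPer_le {m : ℕ} (hm : 0 < m) {w : List Bool} (hw0 : w ≠ []) (hw : m ≤ w.length + 3)
    (i t : ℕ) : occ w (win (dbPer m) i (t * 2 ^ m)) ≤ 8 * t := by
  wlog hle : w.length ≤ m generalizing w
  · have h := this (w := w.take m) (by simp [hw0]; omega) (by simp; omega) (by simp)
    exact (occ_le_occ_of_prefix (List.take_prefix m w) _).trans h
  have hl : 0 < w.length := List.length_pos_iff.2 hw0
  have h8 : 2 ^ (m - w.length) ≤ 8 := (Nat.pow_le_pow_right (by norm_num) (by omega)).trans_eq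
    (by norm_num : 2 ^ 3 = 8)
  rw [win_eq_initial, occ_initial]
  calc _ ≤ (Finset.range t ×ˢ
        ((Finset.range (2 ^ m)).filter fun i => win (dbPer m) i w.length = w)).card := ?_
    _ ≤ t * 8 := by
      rw [Finset.card_product, Finset.card_range]
      exact Nat.mul_le_mul_left _ ((card_win_dbPer_le hm hle).trans h8)
    _ = 8 * t := Nat.mul_comm _ _
  -- A position is encoded by the number of its period and its residue. As `w` is non-empty, it
  -- cannot be the end position `t * 2 ^ m`, so the first entry is less than `t`.
  refine Finset.card_le_card_of_injOn (fun a => (a / 2 ^ m, (i + a) % 2 ^ m)) ?_ ?_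
  · intro a ha
    simp only [Finset.coe_filter, Finset.mem_range, Set.mem_ofPred_eq] at ha
    simp only [Finset.coe_product, Set.mem_prod, Finset.coe_filter, Finset.mem_range,
      Finset.coe_range, Set.mem_Iio, Set.mem_ofPred_eq]
    refine ⟨Nat.div_lt_of_lt_mul (by rw [Nat.mul_comm]; omega), Nat.mod_lt _ (by positivity), ?_⟩
    rw [win_dbPer_mod, ← ha.2]
    simp [win, Nat.add_assoc]
  · intro a _ b _ h
    simp only [Prod.mk.injEq] at h
    have h2 : a % 2 ^ m = b % 2 ^ m := Nat.ModEq.add_left_cancel' i h.2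
    rw [← Nat.div_add_mod a (2 ^ m), ← Nat.div_add_mod b (2 ^ m), h.1, h2]

theorem two_pow_mul_oddFactor (n : ℕ) : 2 ^ twoExp n * oddFactor n = n :=
  Nat.mul_div_cancel' pow_padicValNat_dvd

theorem two_pow_twoExp_le {n : ℕ} (hn : 0 < n) : 2 ^ twoExp n ≤ n :=
  Nat.le_of_dvd hn pow_padicValNat_dvd

theorem oddFactor_le (n : ℕ) : oddFactor n ≤ n := Nat.div_le_self _ _

theorem flatten_replicate_win {a : ℕ → Bool} {N : ℕ} (ha : ∀ i, a (i + N) = a i) (i t : ℕ) :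
    (List.replicate t (win a i N)).flatten = win a i (t * N) := by
  induction t with
  | zero => simp [win]
  | succ t ih =>
    rw [List.replicate_succ, List.flatten_cons, ih, Nat.succ_mul, Nat.add_comm, win_add]
    congr 1
    rw [win_eq_iff]
    intro j _
    rw [Nat.add_right_comm, ha]

theorem block_eq_win {m i : ℕ} (hm : 0 < m) (hi : i ≤ 2 ^ m) :
    block m i = win (dbPer m) i (oddFactor m * 2 ^ m) := by
  rw [← flatten_replicate_win (dbPer_periodic m), block]
  congr 2
  rw [List.rotate_eq_drop_append_take (by rwa [(isDeBruijn_db hm).1]), ← initial_dbPer hm,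
    drop_initial _ hi, take_initial _ hi]
  conv_rhs => rw [← Nat.sub_add_cancel hi, win_add, Nat.add_sub_cancel' hi]
  congr 1
  rw [← win_zero_left, win_eq_iff]
  intro j _
  rw [Nat.zero_add, Nat.add_comm, dbPer_periodic]

/-- The list of the blocks of the first `n` sections. -/
noncomputable def blocks (n : ℕ) : List (List Bool) :=
  (List.range n).flatMap fun j => (List.range (2 ^ twoExp (j + 1))).map (block (j + 1))

theorem flatten_blocks (n : ℕ) : (blocks n).flatten = firstSecs n := by
  simp [blocks, firstSecs, sec, List.flatMap, List.flatten_flatten, Function.comp_def]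

theorem length_blocks_le (n : ℕ) : (blocks n).length ≤ n ^ 2 := by
  have h : ((List.range n).map fun j => 2 ^ twoExp (j + 1)).sum ≤
      ((List.range n).map fun j => 2 ^ twoExp (j + 1)).length • n := by
    refine List.sum_le_card_nsmul _ _ fun x hx => ?_
    obtain ⟨j, hj, rfl⟩ := List.mem_map.1 hx
    exact (two_pow_twoExp_le j.succ_pos).trans (List.mem_range.1 hj)
  rw [blocks, List.length_flatMap]
  simpa [sq] using h

theorem mem_blocks {n : ℕ} {y : List Bool} (hy : y ∈ blocks n) :
    ∃ m i, 0 < m ∧ m ≤ n ∧ y = win (dbPer m) i (oddFactor m * 2 ^ m) := by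
  simp only [blocks, List.mem_flatMap, List.mem_map, List.mem_range] at hy
  obtain ⟨j, hj, i, hi, rfl⟩ := hy
  refine ⟨j + 1, i, j.succ_pos, hj, block_eq_win j.succ_pos ?_⟩
  exact hi.le.trans ((two_pow_twoExp_le j.succ_pos).trans Nat.lt_two_pow_self.le)

theorem firstSecs_succ (n : ℕ) : firstSecs (n + 1) = firstSecs n ++ sec (n + 1) := by
  simp [firstSecs, List.range_succ]

theorem length_sec (n : ℕ) : (sec (n + 1)).length = (n + 1) * 2 ^ (n + 1) := by
  rw [sec, List.length_flatMap]
  have h : ∀ i ∈ List.range (2 ^ twoExp (n + 1)),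
      (block (n + 1) i).length = oddFactor (n + 1) * 2 ^ (n + 1) := by
    intro i hi
    rw [block_eq_win n.succ_pos, length_win]
    exact (List.mem_range.1 hi).le.trans
      ((two_pow_twoExp_le n.succ_pos).trans Nat.lt_two_pow_self.le)
  rw [List.map_congr_left h]
  simp only [List.map_const', List.sum_replicate, List.length_range, smul_eq_mul]
  rw [← Nat.mul_assoc, two_pow_mul_oddFactor]

/-- The length of the first `n` sections. -/
noncomputable def secEnd (n : ℕ) : ℕ := (firstSecs n).length

theorem secEnd_zero : secEnd 0 = 0 := by simp [secEnd, firstSecs]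

theorem secEnd_succ (n : ℕ) : secEnd (n + 1) = secEnd n + (n + 1) * 2 ^ (n + 1) := by
  rw [secEnd, firstSecs_succ, List.length_append, length_sec, secEnd]

theorem secEnd_mono : Monotone secEnd :=
  monotone_nat_of_le_succ fun n => by rw [secEnd_succ]; omega

theorem le_secEnd (n : ℕ) : n ≤ secEnd n := by
  induction n with
  | zero => simp
  | succ n ih =>
    rw [secEnd_succ]
    have : 0 < (n + 1) * 2 ^ (n + 1) := by positivity
    omega

theorem mul_two_pow_le_secEnd (n : ℕ) : n * 2 ^ n ≤ secEnd n := by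
  cases n with
  | zero => simp
  | succ n => rw [secEnd_succ]; omega

theorem secEnd_le (n : ℕ) : secEnd n ≤ n * 2 ^ (n + 1) := by
  induction n with
  | zero => simp [secEnd_zero]
  | succ n ih =>
    rw [secEnd_succ]
    calc _ ≤ n * 2 ^ (n + 1) + (n + 1) * 2 ^ (n + 1) := by omega
      _ ≤ (n + 1) * 2 ^ (n + 1 + 1) := by rw [pow_succ 2 (n + 1)]; nlinarith [Nat.one_le_two_pow (n := n + 1)]

theorem firstSecs_prefix {m n : ℕ} (h : m ≤ n) : firstSecs m <+: firstSecs n := by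
  induction n, h using Nat.le_induction with
  | base => exact List.prefix_rfl
  | succ n _ ih => rw [firstSecs_succ]; exact ih.trans (List.prefix_append _ _)

theorem seqS_eq {n k : ℕ} (h : k < secEnd n) : seqS k = (firstSecs n).getD k false := by
  have h1 : k < (firstSecs (k + 1)).length := (Nat.lt_succ_self k).trans_le (le_secEnd (k + 1))
  rw [seqS, List.getD_eq_getElem _ _ h1, List.getD_eq_getElem _ _ h]
  rcases le_total (k + 1) n with hle | hle
  · exact (firstSecs_prefix hle).getElem h1
  · exact ((firstSecs_prefix hle).getElem h).symm

theorem initial_seqS_secEnd (n : ℕ) : initial seqS (secEnd n) = firstSecs n := by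
  conv_rhs => rw [← initial_getD (firstSecs n)]
  refine List.map_congr_left fun j hj => ?_
  exact seqS_eq (by simpa using hj)

/-- Each of at most `n ^ 2` blocks contains at most `8 * n` occurrences, and each seam adds at most
`n`. The slack of 3 in the length serves `cost_seqS_le`. -/
theorem occ_firstSecs_le {n : ℕ} {w : List Bool} (hw0 : w ≠ []) (hw : n ≤ w.length + 3)
    (hw' : w.length ≤ n) : occ w (firstSecs n) ≤ 10 * n ^ 3 := by
  have hl : 0 < w.length := List.length_pos_iff.2 hw0
  rw [← flatten_blocks]
  have h := occ_flatten_le w (8 * n) (blocks n) (fun y hy => by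
    obtain ⟨m, i, hm0, hm, rfl⟩ := mem_blocks hy
    exact (occ_win_dbPer_le hm0 hw0 (by omega) i _).trans
      (Nat.mul_le_mul_left _ ((oddFactor_le m).trans hm)))
  calc _ ≤ _ := h
    _ ≤ n ^ 2 * (8 * n + n) + 1 := by gcongr; exact length_blocks_le n
    _ ≤ 10 * n ^ 3 := by nlinarith [Nat.one_le_pow 3 n (by omega)]

theorem oddFactor_of_odd {n : ℕ} (h : Odd n) : oddFactor n = n := by
  have : twoExp n = 0 := padicValNat.eq_zero_of_not_dvd (by simpa [← even_iff_two_dvd] using h)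
  simp [oddFactor, this]

theorem win_infix_win {a : ℕ → Bool} {i j l m : ℕ} (h1 : i ≤ j) (h2 : j + l ≤ i + m) :
    win a j l <:+: win a i m := by
  obtain ⟨d, rfl⟩ := Nat.exists_eq_add_of_le h1
  obtain ⟨e, rfl⟩ := Nat.exists_eq_add_of_le (show d + l ≤ m by omega)
  rw [win_add, win_add]
  exact List.infix_append _ _ _

/-- For odd `m` the section is the single block `db m` repeated `m ≥ 2` times, so every cyclic
window of `db m` is read in it without wrapping around. -/
theorem infix_firstSecs_of_odd {m : ℕ} (hodd : Odd m) (hm : 2 ≤ m) {w : List Bool}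
    (hw : w.length ≤ m) : w <:+: firstSecs m := by
  obtain ⟨k, rfl⟩ := Nat.exists_eq_succ_of_ne_zero (by omega : m ≠ 0)
  obtain ⟨i, hi, h⟩ := exists_win_dbPer_eq k.succ_pos
    (w := w ++ List.replicate (k + 1 - w.length) false) (by simp; omega)
  have hb : block (k + 1) 0 <:+: firstSecs (k + 1) := by
    rw [firstSecs_succ, sec]
    refine List.IsInfix.trans ?_ (List.suffix_append _ _).isInfix
    exact List.infix_of_mem_flatten (List.mem_map.2 ⟨0, by simp, rfl⟩)
  refine List.IsInfix.trans ?_ hb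
  rw [block_eq_win k.succ_pos (Nat.zero_le _), oddFactor_of_odd hodd]
  refine (List.prefix_append w (List.replicate (k + 1 - w.length) false)).isInfix.trans ?_
  rw [← h]
  refine win_infix_win (Nat.zero_le _) ?_
  have : k + 1 < 2 ^ (k + 1) := Nat.lt_two_pow_self
  nlinarith

/-- Once the first `n` sections have been read, every string of length less than `n` has been
seen. -/
theorem infix_firstSecs {n : ℕ} (hn : 3 ≤ n) {w : List Bool} (hw : w.length < n) :
    w <:+: firstSecs n := by
  rcases Nat.even_or_odd n with h | h
  · have h1 : Odd (n - 1) := by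
      obtain ⟨k, rfl⟩ := h
      exact ⟨k - 1, by omega⟩
    exact (infix_firstSecs_of_odd h1 (by omega) (by omega)).trans
      (firstSecs_prefix (Nat.sub_le n 1)).isInfix
  · exact infix_firstSecs_of_odd h (by omega) hw.le

/-! ### Factors -/

/-- The set of the factors of length `l` of `x`. -/
def factors (l : ℕ) (x : List Bool) : Finset (List Bool) :=
  (Finset.range (x.length + 1 - l)).image fun i => (x.drop i).take l

theorem mem_factors {l : ℕ} {x w : List Bool} : w ∈ factors l x ↔ w.length = l ∧ w <:+: x := by
  simp only [factors, Finset.mem_image, Finset.mem_range]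
  constructor
  · rintro ⟨i, hi, rfl⟩
    exact ⟨by simp; omega, (List.take_prefix _ _).isInfix.trans (List.drop_suffix _ _).isInfix⟩
  · rintro ⟨rfl, u, v, rfl⟩
    refine ⟨u.length, by simp; omega, ?_⟩
    rw [List.append_assoc, List.drop_left, List.take_left]

theorem factors_initial (l : ℕ) (a : ℕ → Bool) (n : ℕ) :
    factors l (initial a n) = (Finset.range (n + 1 - l)).image fun i => win a i l := by
  rw [factors, length_initial]
  refine Finset.image_congr fun i hi => ?_
  have : i < n + 1 - l := by simpa using hi
  rw [drop_initial a (by omega), win_eq_initial, take_initial _ (by omega), ← win_eq_initial]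

theorem card_factors_append_sdiff_le (l : ℕ) (x y : List Bool) (P : Finset (List Bool)) :
    (factors l (x ++ y) \ P).card ≤ (factors l x \ P).card + (factors l y \ P).card + l := by
  have hsub : factors l (x ++ y) \ P ⊆ ((factors l x \ P) ∪ (factors l y \ P)) ∪
      (Finset.Ico (x.length + 1 - l) (x.length + 1)).image fun i => ((x ++ y).drop i).take l := by
    intro w hw
    simp only [Finset.mem_sdiff, Finset.mem_union, Finset.mem_image, Finset.mem_Ico] at hw ⊢
    obtain ⟨⟨i, hi, rfl⟩, hP⟩ := And.imp_left Finset.mem_image.1 hw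
    simp only [Finset.mem_range, List.length_append] at hi
    by_cases h1 : i + l ≤ x.length
    · left; left
      refine ⟨Finset.mem_image.2 ⟨i, by simp; omega, ?_⟩, hP⟩
      rw [List.drop_append_of_le_length (by omega), List.take_append_of_le_length (by simp; omega)]
    · by_cases h2 : x.length ≤ i
      · left; right
        refine ⟨Finset.mem_image.2 ⟨i - x.length, by simp; omega, ?_⟩, hP⟩
        rw [List.drop_append, List.drop_eq_nil_of_le h2, List.nil_append]
      · right
        exact ⟨i, by omega, rfl⟩
  refine (Finset.card_le_card hsub).trans ((Finset.card_union_le _ _).trans ?_)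
  refine Nat.add_le_add (Finset.card_union_le _ _) (Finset.card_image_le.trans ?_)
  rw [Nat.card_Ico]
  omega

theorem card_factors_flatten_sdiff_le (l : ℕ) (ys : List (List Bool)) (P : Finset (List Bool))
    (h : ∀ y ∈ ys, factors l y ⊆ P) : (factors l ys.flatten \ P).card ≤ ys.length * l + 1 := by
  induction ys with
  | nil =>
    refine (Finset.card_le_card Finset.sdiff_subset).trans (Finset.card_image_le.trans ?_)
    simp
  | cons y ys ih =>
    have h1 := card_factors_append_sdiff_le l y ys.flatten P
    have h2 := ih fun z hz => h z (List.mem_cons_of_mem _ hz)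
    have h3 : factors l y \ P = ∅ := Finset.sdiff_eq_empty_iff_subset.2 (h y List.mem_cons_self)
    rw [h3, Finset.card_empty] at h1
    rw [List.flatten_cons, List.length_cons, Nat.succ_mul]
    omega

/-- The exponential term does not depend on `l`: the set `P` of windows of the periodic sequences of
order at most `n` has at most `2 ^ (n + 1)` elements, and the other factors straddle seams. -/
theorem card_factors_firstSecs_le (n l : ℕ) :
    (factors l (firstSecs n)).card ≤ 2 ^ (n + 1) + n ^ 2 * l + 1 := by
  let P : Finset (List Bool) := (Finset.range (n + 1)).biUnion fun m =>
    (Finset.range (2 ^ m)).image fun i => win (dbPer m) i l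
  have hP : P.card ≤ 2 ^ (n + 1) := by
    refine Finset.card_biUnion_le.trans ((Finset.sum_le_sum fun m _ =>
      Finset.card_image_le).trans ?_)
    simp only [Finset.card_range]
    rw [Nat.geomSum_eq le_rfl]
    exact (Nat.div_le_self _ _).trans (Nat.sub_le _ _)
  have h := card_factors_flatten_sdiff_le l (blocks n) P fun y hy => by
    obtain ⟨m, i, -, hm, rfl⟩ := mem_blocks hy
    intro w hw
    rw [win_eq_initial, factors_initial] at hw
    obtain ⟨a, -, rfl⟩ := Finset.mem_image.1 hw
    refine Finset.mem_biUnion.2 ⟨m, by simp; omega, Finset.mem_image.2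
      ⟨(i + a) % 2 ^ m, by simpa using Nat.mod_lt _ (by positivity), ?_⟩⟩
    rw [win_dbPer_mod]
    simp [win, Nat.add_assoc]
  rw [flatten_blocks] at h
  have h2 := Finset.card_le_card_sdiff_add_card (s := factors l (firstSecs n)) (t := P)
  have h3 := Nat.mul_le_mul_right l (length_blocks_le n)
  omega

/-- The right special factors of length `l` of `x`: those that are followed by both bits. -/
def rightSpecial (l : ℕ) (x : List Bool) : Finset (List Bool) :=
  (factors l x).filter fun w => w ++ [false] <:+: x ∧ w ++ [true] <:+: x

/-- Every factor extends to the right within `x`, except possibly the suffix of length `l`, and the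
right special ones extend in two ways. -/
theorem card_rightSpecial_add_le (l : ℕ) (x : List Bool) :
    (rightSpecial l x).card + (factors l x).card ≤ (factors (l + 1) x).card + 1 := by
  let E : Bool → Finset (List Bool) := fun b => (factors l x).filter fun w => w ++ [b] <:+: x
  have hRS : rightSpecial l x = E false ∩ E true := by
    rw [rightSpecial, ← Finset.filter_and]
  have hcover : factors l x ⊆ (E false ∪ E true) ∪ {x.drop (x.length - l)} := by
    intro w hw
    obtain ⟨hl, u, v, h⟩ := mem_factors.1 hw
    cases v with
    | nil =>
      refine Finset.mem_union_right _ (Finset.mem_singleton.2 ?_)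
      rw [← h, List.append_nil, List.length_append, hl, Nat.add_sub_cancel, List.drop_left]
    | cons b v =>
      refine Finset.mem_union_left _ ?_
      have : w ∈ E b := Finset.mem_filter.2 ⟨hw, u, v, by simp [← h]⟩
      cases b
      · exact Finset.mem_union_left _ this
      · exact Finset.mem_union_right _ this
  have hext : (E false).card + (E true).card ≤ (factors (l + 1) x).card := by
    have hinj : ∀ b : Bool, Function.Injective fun w : List Bool => w ++ [b] := fun b =>
      List.append_left_injective [b]
    rw [← Finset.card_image_of_injective (E false) (hinj false),
      ← Finset.card_image_of_injective (E true) (hinj true), ← Finset.card_union_of_disjoint]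
    · refine Finset.card_le_card fun w hw => ?_
      simp only [Finset.mem_union, Finset.mem_image, E, Finset.mem_filter] at hw
      rcases hw with ⟨u, ⟨hu, h⟩, rfl⟩ | ⟨u, ⟨hu, h⟩, rfl⟩ <;>
        exact mem_factors.2 ⟨by simp [(mem_factors.1 hu).1], h⟩
    · refine Finset.disjoint_left.2 fun w h1 h2 => ?_
      obtain ⟨u, -, rfl⟩ := Finset.mem_image.1 h1
      obtain ⟨v, -, h⟩ := Finset.mem_image.1 h2
      simpa using (List.append_inj' h rfl).2
  have h1 := (Finset.card_le_card hcover).trans (Finset.card_union_le _ _)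
  have h2 := Finset.card_union_add_card_inter (E false) (E true)
  rw [Finset.card_singleton] at h1
  rw [hRS]
  omega

/-- Some length between `n` and `n + D` has few right special factors. -/
theorem exists_card_rightSpecial_le (x : List Bool) (n : ℕ) {D : ℕ} (hD : 0 < D) :
    ∃ l, n ≤ l ∧ l < n + D ∧
      D * (rightSpecial l x).card ≤ (factors (n + D) x).card + D := by
  by_contra! hc
  have hsum : ∀ d, ∑ i ∈ Finset.range d, (rightSpecial (n + i) x).card ≤
      (factors (n + d) x).card + d := by
    intro d
    induction d with
    | zero => simp
    | succ d ih =>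
      rw [Finset.sum_range_succ]
      have := card_rightSpecial_add_le (n + d) x
      rw [← Nat.add_assoc n d 1]
      omega
  -- If every length had too many, the sum over `D` lengths would exceed its telescoped bound.
  have hlt : D * ∑ i ∈ Finset.range D, (rightSpecial (n + i) x).card >
      D * ((factors (n + D) x).card + D) := by
    rw [Finset.mul_sum]
    calc D * ((factors (n + D) x).card + D)
        = ∑ _i ∈ Finset.range D, ((factors (n + D) x).card + D) := by simp
      _ < _ := Finset.sum_lt_sum_of_nonempty (by simpa using hD.ne') fun i hi =>
          hc (n + i) (by omega) (by simpa using hi)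
  exact absurd (Nat.mul_le_mul_left D (hsum D)) (by omega)

/-! ### Counting the positions that are hard to predict -/

theorem card_filter_win_eq_le (S : ℕ → Bool) (N l : ℕ) (w : List Bool) (hw : w.length = l) :
    ((Finset.Ico l N).filter fun p => win S (p - l) l = w).card ≤ occ w (initial S N) := by
  subst hw
  rw [occ_initial]
  refine Finset.card_le_card_of_injOn (fun p => p - w.length) ?_ ?_
  · intro p hp
    simp only [Finset.coe_filter, Finset.mem_Ico, Finset.mem_range, Set.mem_ofPred_eq] at hp ⊢
    exact ⟨by omega, hp.2⟩
  · intro p hp q hq h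
    simp only [Finset.coe_filter, Finset.mem_Ico, Set.mem_ofPred_eq] at hp hq h
    omega

/-- A string has fewer than `K` earlier occurrences at no more than `K` of its occurrences. -/
theorem card_filter_occ_lt_le (S : ℕ → Bool) (N l K : ℕ) (w : List Bool) (hw : w.length = l + 1) :
    ((Finset.Ico l N).filter fun p =>
      win S (p - l) (l + 1) = w ∧ occ w (initial S p) < K).card ≤ K := by
  conv_rhs => rw [← Finset.card_range K]
  refine Finset.card_le_card_of_injOn (fun p => occ w (initial S p)) ?_ ?_
  · intro p hp
    simp only [Finset.coe_filter, Set.mem_ofPred_eq] at hp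
    simpa using hp.2.2
  -- The number of earlier occurrences strictly increases from one occurrence to the next, so it
  -- takes each value below `K` at most once.
  · have key : ∀ p q, l ≤ p → win S (p - l) (l + 1) = w → p < q →
        occ w (initial S p) < occ w (initial S q) := by
      intro p q hp h hpq
      rw [← hw] at h
      rcases occ_initial_succ_of_win h with h1 | h1
      · rw [hw, show p - l + (l + 1) = p + 1 by omega, Nat.add_sub_cancel] at h1
        have := occ_initial_mono w S (show p + 1 ≤ q from hpq)
        omega
      · simp [h1] at hw
    intro p hp q hq h
    simp only [Finset.coe_filter, Finset.mem_Ico, Set.mem_ofPred_eq] at hp hq h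
    rcases lt_trichotomy p q with hpq | hpq | hpq
    · have := key p q hp.1.1 hp.2.1 hpq; omega
    · exact hpq
    · have := key q p hq.1.1 hq.2.1 hpq; omega

open Classical in
/-- All positions before `N` except for few have a context of length `l` that has always been
followed by the next bit, at least `K` times. -/
theorem card_bad_le (S : ℕ → Bool) (N l K C : ℕ)
    (hC : ∀ w : List Bool, w.length = l → occ w (initial S N) ≤ C) :
    ((Finset.range N).filter fun p => ¬ ∃ w, w <:+ initial S p ∧
      cnt (initial S p) w (!(S p)) = 0 ∧ K ≤ cnt (initial S p) w (S p)).card ≤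
      l + (rightSpecial l (initial S N)).card * C + (factors (l + 1) (initial S N)).card * K := by
  set X := initial S N
  -- A bad position is among the first `l`, or its context is right special, or context and next bit
  -- together have occurred fewer than `K` times.
  have hsub : ((Finset.range N).filter fun p => ¬ ∃ w, w <:+ initial S p ∧
      cnt (initial S p) w (!(S p)) = 0 ∧ K ≤ cnt (initial S p) w (S p)) ⊆
      (Finset.range l ∪ (rightSpecial l X).biUnion fun w =>
        (Finset.Ico l N).filter fun p => win S (p - l) l = w) ∪
      (factors (l + 1) X).biUnion fun w => (Finset.Ico l N).filter fun p =>
        win S (p - l) (l + 1) = w ∧ occ w (initial S p) < K := by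
    intro p hp
    simp only [Finset.mem_filter, Finset.mem_range] at hp
    obtain ⟨hpN, hp⟩ := hp
    simp only [Finset.mem_union, Finset.mem_biUnion, Finset.mem_filter, Finset.mem_range,
      Finset.mem_Ico]
    by_contra! hc
    obtain ⟨⟨hl, hrs⟩, hfew⟩ := hc
    apply hp
    have hwin : win S (p - l) (l + 1) = win S (p - l) l ++ [S p] := by
      rw [win_succ, Nat.sub_add_cancel hl]
    have hX : win S (p - l) (l + 1) <:+: X := by
      rw [show X = win S 0 N from (win_zero_left S N).symm]; exact win_infix_win (by omega) (by omega)
    refine ⟨win S (p - l) l, win_suffix_initial S hl, ?_, ?_⟩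
    · by_contra hne
      have h1 : win S (p - l) l ++ [!(S p)] <:+: X := by
        refine (occ_pos_iff.1 (Nat.pos_of_ne_zero hne)).trans ?_
        rw [show X = initial S p ++ _ from initial_eq_append_win S hpN.le]
        exact (List.prefix_append _ _).isInfix
      rw [hwin] at hX
      refine hrs (win S (p - l) l) (Finset.mem_filter.2 ⟨mem_factors.2 ⟨by simp,
        (List.prefix_append _ _).isInfix.trans hX⟩, ?_⟩) ⟨hl, hpN⟩ rfl
      cases hb : S p
      · rw [hb] at hX h1; exact ⟨hX, h1⟩
      · rw [hb] at hX h1; exact ⟨h1, hX⟩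
    · have := hfew _ (mem_factors.2 ⟨by simp, hX⟩) ⟨hl, hpN⟩ rfl
      rwa [hwin] at this
  refine (Finset.card_le_card hsub).trans ((Finset.card_union_le _ _).trans ?_)
  refine Nat.add_le_add ((Finset.card_union_le _ _).trans (Nat.add_le_add (by simp) ?_)) ?_
  · refine Finset.card_biUnion_le_card_mul _ _ _ fun w hw => ?_
    have hwl := (mem_factors.1 (Finset.mem_filter.1 hw).1).1
    exact (card_filter_win_eq_le S N l w hwl).trans (hC w hwl)
  · refine Finset.card_biUnion_le_card_mul _ _ _ fun w hw => ?_
    exact card_filter_occ_lt_le S N l K w (mem_factors.1 hw).1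

/-! ### The compression ratio -/

theorem chainProb_le_one (x : List Bool) (b : Bool) (ws : List (List Bool)) :
    chainProb x b ws ≤ 1 := by
  induction ws with
  | nil => norm_num [chainProb]
  | cons w ws ih =>
    rw [chainProb]
    split_ifs
    · refine div_le_one_of_le₀ ?_ (by positivity)
      rw [total]; cases b <;> exact_mod_cast (by omega)
    · have h : (escCnt x w : ℚ) / total x w ≤ 1 := by
        refine div_le_one_of_le₀ ?_ (by positivity)
        rw [total]; exact_mod_cast (by omega)
      exact (mul_le_of_le_one_right (by positivity) ih).trans h

/-- The number of bits, in the sense of arithmetic coding, that bit `p` of `S` costs. -/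
noncomputable def cost (S : ℕ → Bool) (p : ℕ) : ℝ :=
  -Real.logb 2 (bitProb (initial S p) (S p) : ℚ)

theorem cost_nonneg (S : ℕ → Bool) (p : ℕ) : 0 ≤ cost S p := by
  have h0 : (0 : ℝ) < (bitProb (initial S p) (S p) : ℚ) := by exact_mod_cast bitProb_pos _ _
  have h1 : ((bitProb (initial S p) (S p) : ℚ) : ℝ) ≤ 1 := by
    exact_mod_cast chainProb_le_one _ _ _
  have := Real.logb_nonpos (b := 2) (by norm_num) h0.le h1
  rw [cost]; linarith

theorem cost_le_of_le {S : ℕ → Bool} {p : ℕ} {q : ℚ} (hq : 0 < q)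
    (h : 1 / q ≤ bitProb (initial S p) (S p)) : cost S p ≤ Real.logb 2 q := by
  have h1 : Real.logb 2 ((1 / q : ℚ) : ℝ) ≤ Real.logb 2 (bitProb (initial S p) (S p) : ℚ) := by
    refine Real.logb_le_logb_of_le (by norm_num) ?_ (by exact_mod_cast h)
    exact_mod_cast one_div_pos.2 hq
  rw [one_div, Rat.cast_inv, Real.logb_inv] at h1
  rw [cost]; linarith

theorem length_ppmStar_le (S : ℕ → Bool) (m : ℕ) :
    ((ppmStar (initial S m)).length : ℝ) ≤ ∑ p ∈ Finset.range m, cost S p + 1 := by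
  have h : -Real.logb 2 ((finalInterval (initial S m)).2 : ℝ) =
      ∑ p ∈ Finset.range m, cost S p := by
    rw [finalInterval_snd, Rat.cast_prod, Real.logb_prod, ← Finset.sum_neg_distrib]
    · rfl
    · intro p _
      exact_mod_cast (bitProb_pos _ _).ne'
  rw [ppmStar, arithCode, List.length_ofFn, codeLength, h]
  exact (Nat.ceil_lt_add_one (Finset.sum_nonneg fun p _ => cost_nonneg S p)).le

theorem logb_two_le {x : ℝ} (hx : 1 ≤ x) : Real.logb 2 x ≤ 2 * Real.log x := by
  have h2 : (1 : ℝ) / 2 ≤ Real.log 2 := by have := Real.log_two_gt_d9; linarith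
  rw [Real.logb, div_le_iff₀ (by linarith)]
  nlinarith [Real.log_nonneg hx]

theorem cost_le_of_deterministic {S : ℕ → Bool} {p K : ℕ} (hK : 2 ≤ K) {w : List Bool}
    (hw : w <:+ initial S p) (h0 : cnt (initial S p) w (!(S p)) = 0)
    (h1 : K ≤ cnt (initial S p) w (S p)) : cost S p ≤ 2 / K := by
  have hK0 : (0 : ℚ) < K := by exact_mod_cast (by omega)
  have hK0' : (0 : ℝ) < K := by exact_mod_cast hK0
  have h := cost_le_of_le (q := ((K : ℚ) + 1) / K) (by positivity)
    (by rw [one_div_div]; exact bitProb_ge_of_deterministic hK hw h0 h1)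
  refine h.trans ?_
  push_cast
  have h2 : ((K : ℝ) + 1) / K = 1 + 1 / K := by field_simp
  have h3 : (1 : ℝ) ≤ 1 + 1 / K := by have : (0 : ℝ) ≤ 1 / K := by positivity
                                      linarith
  rw [h2]
  refine (logb_two_le h3).trans ?_
  have := Real.log_le_sub_one_of_pos (show (0 : ℝ) < 1 + 1 / K by positivity)
  have h4 : (2 : ℝ) / K = 2 * (1 / K) := by ring
  rw [h4]; linarith

theorem cost_seqS_le {n p : ℕ} (h0 : secEnd 3 ≤ p) (hp : p < secEnd n) :
    cost seqS p ≤ 10 * (2 * Real.log n) := by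
  classical
  have hex : ∃ k, p < secEnd k := ⟨n, hp⟩
  let k := Nat.find hex
  have hk : p < secEnd k := Nat.find_spec hex
  have hkn : k ≤ n := Nat.find_min' hex hp
  have hk4 : 4 ≤ k := by
    by_contra! hc
    exact absurd (secEnd_mono (show k ≤ 3 by omega)) (by omega)
  have hkp : secEnd (k - 1) ≤ p := not_lt.1 (Nat.find_min hex (show k - 1 < k by omega))
  have hseen : ∀ w : List Bool, w.length < k - 1 → 0 < occ w (initial seqS p) := fun w hw => by
    refine (occ_pos_iff.2 (infix_firstSecs (by omega) hw)).trans_le ?_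
    rw [← initial_seqS_secEnd]
    exact occ_initial_mono w seqS hkp
  -- Here `k` is the section being read. Words of length `k - 3` followed by a bit are shorter than
  -- `k - 1`, so sections before `k` contain them; `k ≥ 4` keeps these words non-empty for the
  -- occurrence bound.
  have hb := bitProb_ge (x := initial seqS p) (r := k - 3) (C := 10 * k ^ 3)
    (by have := le_secEnd (k - 1); simp; omega)
    (fun v hv => escCnt_eq_two fun b => hseen _ (by simp; omega))
    (fun v hv => by
      refine (occ_initial_mono v seqS hk.le).trans ?_
      rw [initial_seqS_secEnd]
      exact occ_firstSecs_le (by rintro rfl; simp at hv; omega) (by omega) (by omega)) (seqS p)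
  have h := cost_le_of_le (by positivity) hb
  refine h.trans ?_
  have hn4 : (4 : ℝ) ≤ n := by exact_mod_cast hk4.trans hkn
  have hkn' : (k : ℝ) ≤ n := by exact_mod_cast hkn
  have h5 : (10 * (k : ℝ) ^ 3 + 2) ≤ (n : ℝ) ^ 5 := by
    have h6 : (k : ℝ) ^ 3 ≤ (n : ℝ) ^ 3 := by gcongr
    have h7 : (16 : ℝ) ≤ (n : ℝ) ^ 2 := by nlinarith
    have h8 : (1 : ℝ) ≤ (n : ℝ) ^ 3 := one_le_pow₀ (by linarith)
    have h9 : (n : ℝ) ^ 5 = n ^ 2 * n ^ 3 := by ring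
    nlinarith
  push_cast
  calc Real.logb 2 ((10 * (k : ℝ) ^ 3 + 2) ^ 2) ≤ Real.logb 2 (((n : ℝ) ^ 5) ^ 2) :=
        Real.logb_le_logb_of_le (by norm_num) (by positivity) (by gcongr)
    _ = 10 * Real.logb 2 n := by rw [← pow_mul, Real.logb_pow]; norm_num
    _ ≤ 10 * (2 * Real.log n) := by gcongr; exact logb_two_le (by linarith)

open Classical in
theorem card_bad_seqS_le {n K : ℕ} (hn : 4 ≤ n) (hK : 2 ≤ K) :
    ((Finset.range (secEnd n)).filter fun p => ¬ ∃ w, w <:+ initial seqS p ∧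
      cnt (initial seqS p) w (!(seqS p)) = 0 ∧ K ≤ cnt (initial seqS p) w (seqS p)).card ≤
      24 * K * (2 ^ n + n ^ 6) := by
  -- The range `n ^ 4` of lengths outweighs the up to `10 * n ^ 3` occurrences of each right special
  -- word, while `n ^ 2 * l` stays below the order of `n ^ 6`.
  obtain ⟨l, hl, hl', hD⟩ := exists_card_rightSpecial_le (firstSecs n) n
    (show 0 < n ^ 4 by positivity)
  have hC : ∀ w : List Bool, w.length = l → occ w (initial seqS (secEnd n)) ≤ 10 * n ^ 3 := by
    intro w hw
    rw [initial_seqS_secEnd]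
    have hlen : (w.take n).length = n := by simp; omega
    refine (occ_le_occ_of_prefix (List.take_prefix n w) _).trans
      (occ_firstSecs_le ?_ (by omega) hlen.le)
    intro h; rw [h] at hlen; simp at hlen; omega
  refine (card_bad_le seqS (secEnd n) l K (10 * n ^ 3) hC).trans ?_
  rw [initial_seqS_secEnd]
  set s := (rightSpecial l (firstSecs n)).card
  have h1 := card_factors_firstSecs_le n (l + 1)
  have h2 := card_factors_firstSecs_le n (n + n ^ 4)
  have e1 : n ^ 2 * (n + n ^ 4 + 1) + n ^ 4 + 1 ≤ 2 * n ^ 6 := by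
    obtain ⟨d, rfl⟩ := Nat.exists_eq_add_of_le hn
    ring_nf
    nlinarith [Nat.zero_le d, Nat.zero_le (d ^ 2), Nat.zero_le (d ^ 3), Nat.zero_le (d ^ 4),
      Nat.zero_le (d ^ 5), Nat.zero_le (d ^ 6)]
  have h3 : (factors (l + 1) (firstSecs n)).card ≤ 2 * 2 ^ n + 2 * n ^ 6 := by
    have : n ^ 2 * (l + 1) ≤ n ^ 2 * (n + n ^ 4 + 1) := by gcongr
    rw [pow_succ] at h1
    omega
  have h4 : n ^ 4 * s ≤ 2 * 2 ^ n + 2 * n ^ 6 := by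
    have : n ^ 2 * (n + n ^ 4) ≤ n ^ 2 * (n + n ^ 4 + 1) :=
      Nat.mul_le_mul_left _ (Nat.le_succ _)
    rw [pow_succ 2 n] at h2
    omega
  have h5 : s * (10 * n ^ 3) ≤ 20 * 2 ^ n + 20 * n ^ 6 := by
    have h6 : n ^ 3 * s ≤ n ^ 4 * s :=
      Nat.mul_le_mul_right s (Nat.pow_le_pow_right (by omega) (by norm_num))
    linarith
  have h7 : l ≤ 2 * n ^ 6 := by
    have : n ^ 2 * (n + n ^ 4 + 1) ≥ n + n ^ 4 + 1 := Nat.le_mul_of_pos_left _ (by positivity)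
    omega
  have h8 := Nat.mul_le_mul_right K h3
  -- As `K ≥ 2`, the terms without a factor `K` are absorbed into those with one.
  have h9 : 2 * (22 * 2 ^ n + 22 * n ^ 6) ≤ K * (22 * 2 ^ n + 22 * n ^ 6) := by gcongr
  clear_value s
  generalize 2 ^ n = a at *
  generalize n ^ 6 = b at *
  generalize s * (10 * n ^ 3) = c at *
  linarith

/-- The constant contribution of the first three sections to the code length. -/
noncomputable def startCost : ℝ := ∑ p ∈ Finset.range (secEnd 3), cost seqS p

theorem sum_cost_le {n K : ℕ} (hn : 4 ≤ n) (hK : 2 ≤ K) :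
    ∑ p ∈ Finset.range (secEnd n), cost seqS p ≤
      startCost + secEnd n * (2 / K) +
        (24 * K * (2 ^ n + n ^ 6)) * (20 * Real.log n) := by
  classical
  have hlog : 0 ≤ Real.log n := Real.log_natCast_nonneg n
  -- Each position is charged as part of the first three sections, as well predicted, or as bad.
  have hpt : ∀ p ∈ Finset.range (secEnd n), cost seqS p ≤
      (if p < secEnd 3 then cost seqS p else 0) + 2 / K +
        (if ¬ ∃ w, w <:+ initial seqS p ∧ cnt (initial seqS p) w (!(seqS p)) = 0 ∧
          K ≤ cnt (initial seqS p) w (seqS p) then 20 * Real.log n else 0) := by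
    intro p hp
    have hK0 : (0 : ℝ) ≤ 2 / K := by positivity
    by_cases h3 : p < secEnd 3
    · rw [if_pos h3]
      have : (0 : ℝ) ≤ if ¬ ∃ w, w <:+ initial seqS p ∧ cnt (initial seqS p) w (!(seqS p)) = 0 ∧
          K ≤ cnt (initial seqS p) w (seqS p) then 20 * Real.log n else 0 := by
        split_ifs <;> positivity
      linarith
    · rw [if_neg h3]
      split_ifs with hbad
      · obtain ⟨w, hw, h0, h1⟩ := hbad
        have := cost_le_of_deterministic hK hw h0 h1
        linarith
      · have := cost_seqS_le (not_lt.1 h3) (Finset.mem_range.1 hp)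
        linarith
  refine (Finset.sum_le_sum hpt).trans ?_
  rw [Finset.sum_add_distrib, Finset.sum_add_distrib, ← Finset.sum_filter, ← Finset.sum_filter,
    Finset.sum_const, Finset.sum_const, Finset.card_range, nsmul_eq_mul, nsmul_eq_mul]
  have hstart : ((Finset.range (secEnd n)).filter fun p => p < secEnd 3) =
      Finset.range (secEnd 3) := by
    have := secEnd_mono (show 3 ≤ n by omega)
    ext p
    simp only [Finset.mem_filter, Finset.mem_range]
    omega
  rw [hstart]
  refine add_le_add le_rfl (mul_le_mul_of_nonneg_right ?_ (by positivity))
  exact_mod_cast card_bad_seqS_le hn hK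

/-- A bound for the compression ratio within section `n`. -/
noncomputable def ratioBound (n : ℕ) : ℝ :=
  4 * ((startCost + 1) / (n * 2 ^ n) + 8 / Real.sqrt n +
    960 * (Real.log n / Real.sqrt n * (1 + (n : ℝ) ^ 6 / 2 ^ n)))

theorem tendsto_ratioBound : Filter.Tendsto ratioBound Filter.atTop (nhds 0) := by
  have hsqrt : Filter.Tendsto (fun n : ℕ => Real.sqrt n) Filter.atTop Filter.atTop :=
    Real.tendsto_sqrt_atTop.comp tendsto_natCast_atTop_atTop
  have hpow : Filter.Tendsto (fun n : ℕ => (n : ℝ) * 2 ^ n) Filter.atTop Filter.atTop :=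
    tendsto_natCast_atTop_atTop.atTop_mul_atTop₀ (tendsto_pow_atTop_atTop_of_one_lt (by norm_num))
  have hlog : Filter.Tendsto (fun n : ℕ => Real.log n / Real.sqrt n) Filter.atTop (nhds 0) := by
    have := (isLittleO_log_rpow_atTop (show (0 : ℝ) < 1 / 2 by norm_num)).tendsto_div_nhds_zero
    simp only [← Real.sqrt_eq_rpow] at this
    exact this.comp tendsto_natCast_atTop_atTop
  have hexp : Filter.Tendsto (fun n : ℕ => (n : ℝ) ^ 6 / 2 ^ n) Filter.atTop (nhds 0) :=
    tendsto_pow_const_div_const_pow_of_one_lt 6 (by norm_num)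
  have h := (((hpow.const_div_atTop (startCost + 1)).add (hsqrt.const_div_atTop 8)).add
    ((hlog.mul (hexp.const_add 1)).const_mul 960)).const_mul 4
  unfold ratioBound
  simpa using h

/-- The choice of `⌊√n⌋` for `K` makes both main terms small. Costs are nonnegative, so section `n`
may be charged in full even if it is only partly read; this loses a constant factor, as `m ≥ (n - 1)
* 2 ^ (n - 1) ≥ n * 2 ^ n / 4`. -/
theorem ratio_le_ratioBound {n m : ℕ} (hn : 4 ≤ n) (h1 : secEnd (n - 1) ≤ m)
    (h2 : m ≤ secEnd n) :
    ((ppmStar (initial seqS m)).length : ℝ) / m ≤ ratioBound n := by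
  set K := Nat.sqrt n
  have hK : 2 ≤ K := Nat.le_sqrt.2 (by omega)
  have hn0 : (0 : ℝ) < n := by exact_mod_cast (by omega)
  have hK0 : (0 : ℝ) < K := by exact_mod_cast (by omega)
  have hs0 : 0 < Real.sqrt n := Real.sqrt_pos.2 hn0
  have hKs : Real.sqrt n ≤ 2 * K := by
    have h3 : Real.sqrt n < K + 1 := Real.real_sqrt_lt_nat_sqrt_succ
    have h4 : (2 : ℝ) ≤ K := by exact_mod_cast hK
    linarith
  have hKs' : (K : ℝ) ≤ Real.sqrt n := Real.nat_sqrt_le_real_sqrt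
  have hlog : 0 ≤ Real.log n := Real.log_natCast_nonneg n
  have hsc : 0 ≤ startCost := Finset.sum_nonneg fun p _ => cost_nonneg seqS p
  have hm : (n : ℝ) * 2 ^ n / 4 ≤ m := by
    have h3 := (mul_two_pow_le_secEnd (n - 1)).trans h1
    obtain ⟨k, rfl⟩ := Nat.exists_eq_add_of_le hn
    have h4 : ((4 + k - 1 : ℕ) : ℝ) * 2 ^ (4 + k - 1) ≤ m := by exact_mod_cast h3
    rw [show 4 + k - 1 = 3 + k by omega] at h4
    refine le_trans ?_ h4
    rw [show 4 + k = 3 + k + 1 by omega, pow_succ]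
    push_cast
    have : (0 : ℝ) < 2 ^ (3 + k) := by positivity
    nlinarith
  have hm0 : (0 : ℝ) < m := lt_of_lt_of_le (by positivity) hm
  have hsum : ∑ p ∈ Finset.range m, cost seqS p ≤ ∑ p ∈ Finset.range (secEnd n), cost seqS p :=
    Finset.sum_le_sum_of_subset_of_nonneg (Finset.range_mono h2) fun p _ _ => cost_nonneg seqS p
  have hlen := (length_ppmStar_le seqS m).trans (add_le_add_left (hsum.trans (sum_cost_le hn hK)) 1)
  have hend : (secEnd n : ℝ) ≤ n * 2 ^ n * 2 := by
    have := secEnd_le n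
    rw [pow_succ, ← mul_assoc] at this
    exact_mod_cast this
  have t1 : (secEnd n : ℝ) * (2 / K) ≤ n * 2 ^ n * (8 / Real.sqrt n) := by
    have : (2 : ℝ) / K ≤ 4 / Real.sqrt n := by
      rw [div_le_div_iff₀ hK0 hs0]; linarith
    calc (secEnd n : ℝ) * (2 / K) ≤ (n * 2 ^ n * 2) * (4 / Real.sqrt n) := by gcongr
      _ = _ := by ring
  have t2 : (24 * K * (2 ^ n + (n : ℝ) ^ 6)) * (20 * Real.log n) ≤
      n * 2 ^ n * (960 * (Real.log n / Real.sqrt n * (1 + (n : ℝ) ^ 6 / 2 ^ n))) := by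
    have e : (n : ℝ) * 2 ^ n * (960 * (Real.log n / Real.sqrt n * (1 + (n : ℝ) ^ 6 / 2 ^ n))) =
        960 * Real.sqrt n * (2 ^ n + (n : ℝ) ^ 6) * Real.log n := by
      have hsq : (n : ℝ) = Real.sqrt n * Real.sqrt n := (Real.mul_self_sqrt hn0.le).symm
      have : (n : ℝ) / Real.sqrt n = Real.sqrt n := by
        rw [div_eq_iff hs0.ne']; exact hsq
      calc _ = 960 * (n / Real.sqrt n) * (2 ^ n * (1 + (n : ℝ) ^ 6 / 2 ^ n)) * Real.log n := by ring
        _ = _ := by rw [this]; field_simp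
    rw [e]
    have h5 : 0 ≤ (2 ^ n + (n : ℝ) ^ 6) * Real.log n := by positivity
    nlinarith [mul_le_mul_of_nonneg_right hKs' h5, mul_nonneg hs0.le h5]
  have t0 : startCost + 1 = n * 2 ^ n * ((startCost + 1) / (n * 2 ^ n)) := by field_simp
  rw [div_le_iff₀ hm0]
  have hpos : 0 ≤ ratioBound n := by rw [ratioBound]; positivity
  calc ((ppmStar (initial seqS m)).length : ℝ) ≤ (n * 2 ^ n / 4) * ratioBound n := by
        rw [ratioBound]; linarith
    _ ≤ m * ratioBound n := by gcongr
    _ = _ := mul_comm _ _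

theorem tendsto_ratio : Filter.Tendsto
    (fun m : ℕ => ((ppmStar (initial seqS m)).length : ℝ) / m) Filter.atTop (nhds 0) := by
  rw [Metric.tendsto_atTop]
  intro ε hε
  obtain ⟨n₀, hn₀⟩ := Metric.tendsto_atTop.1 tendsto_ratioBound ε hε
  refine ⟨secEnd (max n₀ 4), fun m hm => ?_⟩
  classical
  have hex : ∃ n, m < secEnd n := ⟨m + 1, (Nat.lt_succ_self m).trans_le (le_secEnd _)⟩
  have hspec := Nat.find_spec hex
  have hlt : max n₀ 4 < Nat.find hex := by
    by_contra! hc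
    exact absurd (secEnd_mono hc) (by omega)
  have hmin := not_lt.1 (Nat.find_min hex (show Nat.find hex - 1 < Nat.find hex by omega))
  have h1 := ratio_le_ratioBound (by omega) hmin hspec.le
  have h2 := hn₀ (Nat.find hex) (by omega)
  rw [Real.dist_eq, sub_zero] at h2 ⊢
  rw [abs_of_nonneg (by positivity)]
  exact (h1.trans (le_abs_self _)).trans_lt h2

end PPMStar

theorem theorem2 : PPMStar.worstCaseRatio PPMStar.ppmStar PPMStar.seqS = 0 := by
  rw [PPMStar.worstCaseRatio]
  refine Filter.Tendsto.limsup_eq ?_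
  have h := ENNReal.tendsto_ofReal PPMStar.tendsto_ratio
  rw [ENNReal.ofReal_zero] at h
  refine h.congr' ?_
  -- Division by 0 follows different conventions in `ℝ` and `ENNReal`, so `m = 0` is left out.
  filter_upwards [Filter.eventually_gt_atTop 0] with m hm
  rw [ENNReal.ofReal_div_of_pos (by exact_mod_cast hm), ENNReal.ofReal_natCast,
    ENNReal.ofReal_natCast]
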